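/- Let $\lambda,\mu>0$ and $\kappa\in\mathbb R$ ($\hbar=1$). A system with Hilbert space $L^2(\mathbb R)$ (position $Q$, momentum $P=-i\,d/dq$) is coupled to two probes with joint Hilbert space $L^2(\mathbb R^2)$ (positions $Q_1,Q_2$, momenta $P_1,P_2$) by the unitary $U=\exp(-iH)$ on $L^2(\mathbb R)\otimes L^2(\mathbb R^2)=L^2(\mathbb R^3)$, where $H$ is the self-adjoint operator determined by $$H=\lambda\,QP_1-\mu\,PQ_2+\tfrac{\lambda\mu}{2}\,\kappa\,P_1Q_2$$ on Schwartz functions. Let $\sigma_{12}$ be an arbitrary density operator (positive operator of trace one) on $L^2(\mathbb R^2)$, the initial state of the probes; it may be pure or mixed, entangled or classically correlated. Let $\mathsf E^{Q_1}$ and $\mathsf E^{P_2}$ be the spectral measures of $Q_1$ and $P_2$, and for a unit vector $\psi\in L^2(\mathbb R)$ let $P_\psi=|\psi\rangle\langle\psi|$. Then there is exactly one normalized positive operator valued measure $\mathsf G=\mathsf G^{(\lambda,\mu)}$ on the Borel sets of $\mathbb R^2$, acting in $L^2(\mathbb R)$, such that for all Borel sets $X,Y\subseteq\mathbb R$ and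 all unit vectors $\psi\in L^2(\mathbb R)$ $$\langle\psi|\mathsf G(X\times Y)\psi\rangle=\operatorname{tr}\big[\,U(P_\psi\otimes\sigma_{12})U^*\,\big(I\otimes\mathsf E^{Q_1}(\lambda X)\otimes\mathsf E^{P_2}(\mu Y)\big)\big],$$ where $\lambda X=\{\lambda x: x\in X\}$ and $\mu Y=\{\mu y:y\in Y\}$. This $\mathsf G$ is a covariant phase space observable: with $W_{qp}=\exp[-i(qP-pQ)]$, $$W_{qp}\,\mathsf G(Z)\,W_{qp}^*=\mathsf G\big(Z+(q,p)\big)\qquad\text{for all }(q,p)\in\mathbb R^2\text{ and all Borel sets }Z\subseteq\mathbb R^2 .$$ -/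

import Mathlib

open MeasureTheory SchwartzMap

noncomputable section

namespace ArthursKelly

/-! ### Hilbert spaces: position representation -/

/-- The Hilbert space `L²(E)` of square-integrable complex functions on a Euclidean space `E`. -/
abbrev L2 (E : Type) [NormedAddCommGroup E] [InnerProductSpace ℝ E] [MeasurableSpace E]
    [BorelSpace E] [FiniteDimensional ℝ E] : Type :=
  Lp ℂ 2 (volume : Measure E)

/-- Configuration space of the two probes, with coordinates `(q₁, q₂)`. -/
abbrev R2 : Type := EuclideanSpace ℝ (Fin 2)

/-- Configuration space of system and probes, with coordinates `(q, q₁, q₂)`. -/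
abbrev R3 : Type := EuclideanSpace ℝ (Fin 3)

section Operators

variable {E : Type} [NormedAddCommGroup E] [InnerProductSpace ℝ E] [MeasurableSpace E]
  [BorelSpace E] [FiniteDimensional ℝ E]

/-! ### Position and momentum -/

/-- The position operator in direction `e` on Schwartz functions, `(Q_e f)(x) = ⟪e, x⟫ f(x)`. -/
def positionOp (e : E) : 𝓢(E, ℂ) →L[ℂ] 𝓢(E, ℂ) :=
  smulLeftCLM ℂ (fun x : E => ((inner ℝ e x : ℝ) : ℂ))

theorem positionOp_apply {E : Type} [NormedAddCommGroup E] [InnerProductSpace ℝ E] (e : E) (f : 𝓢(E, ℂ)) (x : E) :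
    positionOp e f x = ((inner ℝ e x : ℝ) : ℂ) * f x := by
  have h : Function.HasTemperateGrowth (fun x : E => ((inner ℝ e x : ℝ) : ℂ)) :=
    (Complex.ofRealCLM.comp (innerSL ℝ e)).hasTemperateGrowth
  simp [positionOp, smulLeftCLM_apply_apply h]

/-- The momentum operator (`ℏ = 1`) in direction `e` on Schwartz functions, `P_e f = -i ∂_e f`. -/
def momentumOp (e : E) : 𝓢(E, ℂ) →L[ℂ] 𝓢(E, ℂ) :=
  (-Complex.I) • LineDeriv.lineDerivOpCLM ℂ 𝓢(E, ℂ) e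

theorem momentumOp_apply {E : Type} [NormedAddCommGroup E] [InnerProductSpace ℝ E] (e : E) (f : 𝓢(E, ℂ)) (x : E) :
    momentumOp e f x = -Complex.I * lineDeriv ℝ f x e := by
  simp [momentumOp, SchwartzMap.lineDerivOp_apply]

/-- Multiplication by the indicator function of `s`, for measurable `s` (and `0` otherwise). -/
def indicatorOp (s : Set E) : L2 E →L[ℂ] L2 E :=
  open Classical in
  if hs : MeasurableSet s then
    LinearMap.mkContinuous
      { toFun := fun f => ((Lp.memLp f).indicator hs).toLp (s.indicator f)
        map_add' := by
          intro f g
          ext1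
          filter_upwards [((Lp.memLp (f + g)).indicator hs).coeFn_toLp,
            ((Lp.memLp f).indicator hs).coeFn_toLp, ((Lp.memLp g).indicator hs).coeFn_toLp,
            Lp.coeFn_add f g, Lp.coeFn_add (((Lp.memLp f).indicator hs).toLp (s.indicator f))
              (((Lp.memLp g).indicator hs).toLp (s.indicator g))] with x h1 h2 h3 h4 h5
          rw [h1, h5, Pi.add_apply, h2, h3]
          by_cases hx : x ∈ s
          · simpa [hx] using h4
          · simp [hx]
        map_smul' := by
          intro c f
          ext1
          filter_upwards [((Lp.memLp (c • f)).indicator hs).coeFn_toLp,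
            ((Lp.memLp f).indicator hs).coeFn_toLp, Lp.coeFn_smul c f,
            Lp.coeFn_smul c (((Lp.memLp f).indicator hs).toLp (s.indicator f))]
            with x h1 h2 h3 h4
          rw [h1, RingHom.id_apply, h4, Pi.smul_apply, h2]
          by_cases hx : x ∈ s
          · simpa [hx] using h3
          · simp [hx] }
      1 (by
        intro f
        rw [one_mul]
        refine Lp.norm_le_norm_of_ae_le ?_
        filter_upwards [((Lp.memLp f).indicator hs).coeFn_toLp] with x hx
        simp only [LinearMap.coe_mk, AddHom.coe_mk]
        rw [hx]
        exact norm_indicator_le_norm_self _ _)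
  else 0

/-- The spectral measure of position in direction `e`: multiplication by the indicator function
of `{x | ⟪e, x⟫ ∈ X}`. -/
def positionPVM (e : E) (X : Set ℝ) : L2 E →L[ℂ] L2 E :=
  indicatorOp {x : E | inner ℝ e x ∈ X}

/-- The spectral measure of momentum in direction `e`. With Mathlib's Fourier transform
`(𝓕 f)(ξ) = ∫ exp(-2πi⟪x, ξ⟫) f(x) dx`, the operator `P_e = -i ∂_e` becomes multiplication by
`2π⟪e, ξ⟫`. -/
def momentumPVM (e : E) (Y : Set ℝ) : L2 E →L[ℂ] L2 E :=
  ((Lp.fourierTransformₗᵢ E ℂ).symm.toContinuousLinearEquiv : L2 E →L[ℂ] L2 E) ∘L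
    indicatorOp {ξ : E | 2 * Real.pi * inner ℝ e ξ ∈ Y} ∘L
    ((Lp.fourierTransformₗᵢ E ℂ).toContinuousLinearEquiv : L2 E →L[ℂ] L2 E)

/-! ### Unitary exponentials -/

/-- `U = exp(-iA)`, for an operator `A` given on Schwartz space: `U` is the value at `t = 1` of a
strongly continuous one-parameter unitary group `V t = exp(-itA)` whose generator extends
`-iA`. -/
def IsExpNegI (A : 𝓢(E, ℂ) →L[ℂ] 𝓢(E, ℂ)) (U : L2 E →L[ℂ] L2 E) : Prop :=
  ∃ V : ℝ → (L2 E ≃ₗᵢ[ℂ] L2 E),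
    (∀ s t : ℝ, ∀ f : L2 E, V (s + t) f = V s (V t f)) ∧
    (∀ f : L2 E, Continuous fun t => V t f) ∧
    (∀ f : 𝓢(E, ℂ), HasDerivAt (fun t => V t (f.toLp 2 volume)) ((-Complex.I) • (A f).toLp 2 volume) 0) ∧
    ∀ f : L2 E, U f = V 1 f

/-- The operator `exp(-iA)`: the unique `U` with `IsExpNegI A U`. If there is no such operator, or
more than one, the value is `0`, which is not a unitary operator. -/
def expNegI (A : 𝓢(E, ℂ) →L[ℂ] 𝓢(E, ℂ)) : L2 E →L[ℂ] L2 E :=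
  open Classical in
  if h : ∃! U, IsExpNegI A U then h.choose else 0

end Operators

/-! ### Tensor products -/

/-- The splitting `(q, q₁, q₂) ↦ (q, (q₁, q₂))`. -/
def split (x : R3) : ℝ × R2 := (x 0, !₂[x 1, x 2])

theorem measurePreserving_split : MeasurePreserving split (volume : Measure R3) volume := by
  have h1 := EuclideanSpace.volume_preserving_symm_measurableEquiv_toLp (Fin 3)
  have h2 := volume_preserving_piFinSuccAbove (fun _ : Fin 3 => ℝ) 0
  have h3 : MeasurePreserving (Prod.map id (MeasurableEquiv.toLp 2 (Fin 2 → ℝ)))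
      (volume : Measure (ℝ × (Fin 2 → ℝ))) (volume : Measure (ℝ × R2)) :=
    (MeasurePreserving.id volume).prod
      (EuclideanSpace.volume_preserving_symm_measurableEquiv_toLp (Fin 2)).symm
  have h : split = Prod.map id (MeasurableEquiv.toLp 2 (Fin 2 → ℝ)) ∘
      (MeasurableEquiv.piFinSuccAbove (fun _ : Fin 3 => ℝ) 0) ∘
      (MeasurableEquiv.toLp 2 (Fin 3 → ℝ)).symm := by
    funext x
    refine Prod.ext rfl ?_
    ext i
    fin_cases i <;> rfl
  rw [h]
  exact h3.comp (h2.comp h1)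

theorem memLp_tensor (ψ : L2 ℝ) (φ : L2 R2) :
    MemLp (fun x : R3 => ψ (split x).1 * φ (split x).2) 2 volume := by
  have hm : MemLp (fun z : ℝ × R2 => ψ z.1 * φ z.2) 2 volume := by
    have hψ := Lp.memLp ψ
    have hφ := Lp.memLp φ
    have hae : AEStronglyMeasurable (fun z : ℝ × R2 => ψ z.1 * φ z.2) volume :=
      hψ.1.comp_fst.mul hφ.1.comp_snd
    rw [memLp_two_iff_integrable_sq_norm hae]
    rw [memLp_two_iff_integrable_sq_norm hψ.1] at hψ
    rw [memLp_two_iff_integrable_sq_norm hφ.1] at hφ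
    simpa [mul_pow, Measure.volume_eq_prod] using hψ.mul_prod hφ
  exact hm.comp_measurePreserving measurePreserving_split

/-- The vector `ψ ⊗ φ` of `L²(ℝ) ⊗ L²(ℝ²) = L²(ℝ³)`,
`(ψ ⊗ φ)(q, q₁, q₂) = ψ(q) φ(q₁, q₂)`. -/
def tensor (ψ : L2 ℝ) (φ : L2 R2) : L2 R3 := (memLp_tensor ψ φ).toLp

theorem inner_tensor (ψ ψ' : L2 ℝ) (φ φ' : L2 R2) :
    inner ℂ (tensor ψ φ) (tensor ψ' φ') = inner ℂ ψ ψ' * inner ℂ φ φ' := by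
  rw [L2.inner_def, L2.inner_def, L2.inner_def, ← integral_prod_mul]
  have h : ∀ᵐ x : R3, inner ℂ (tensor ψ φ x) (tensor ψ' φ' x) =
      (fun z : ℝ × R2 => inner ℂ (ψ z.1) (ψ' z.1) * inner ℂ (φ z.2) (φ' z.2)) (split x) := by
    filter_upwards [(memLp_tensor ψ φ).coeFn_toLp, (memLp_tensor ψ' φ').coeFn_toLp] with x h1 h2
    rw [tensor, tensor, h1, h2]
    simp
    ring
  rw [integral_congr_ae h, ← integral_map (f := fun z : ℝ × R2 =>
    inner ℂ (ψ z.1) (ψ' z.1) * inner ℂ (φ z.2) (φ' z.2))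
    measurePreserving_split.measurable.aemeasurable, measurePreserving_split.map_eq]
  · rfl
  · rw [measurePreserving_split.map_eq]
    exact (((Lp.aestronglyMeasurable ψ).inner (Lp.aestronglyMeasurable ψ')).comp_fst).mul
      (((Lp.aestronglyMeasurable φ).inner (Lp.aestronglyMeasurable φ')).comp_snd)

theorem norm_tensor (ψ : L2 ℝ) (φ : L2 R2) : ‖tensor ψ φ‖ = ‖ψ‖ * ‖φ‖ := by
  have h := inner_tensor ψ ψ φ φ
  simp only [inner_self_eq_norm_sq_to_K] at h
  have h' : ‖tensor ψ φ‖ ^ 2 = (‖ψ‖ * ‖φ‖) ^ 2 := by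
    rw [mul_pow]
    exact_mod_cast h
  exact (pow_left_inj₀ (norm_nonneg _) (by positivity) two_ne_zero).1 h'

theorem tensor_add (ψ : L2 ℝ) (φ φ' : L2 R2) :
    tensor ψ (φ + φ') = tensor ψ φ + tensor ψ φ' := by
  ext1
  filter_upwards [(memLp_tensor ψ (φ + φ')).coeFn_toLp, (memLp_tensor ψ φ).coeFn_toLp,
    (memLp_tensor ψ φ').coeFn_toLp, Lp.coeFn_add (tensor ψ φ) (tensor ψ φ'),
    (Measure.quasiMeasurePreserving_snd.comp measurePreserving_split.quasiMeasurePreserving).ae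
      (Lp.coeFn_add φ φ')] with x h1 h2 h3 h4 h5
  rw [h4, Pi.add_apply, tensor, tensor, tensor, h1, h2, h3]
  simp only [Function.comp_apply, Pi.add_apply] at h5
  rw [h5, mul_add]

theorem tensor_smul (ψ : L2 ℝ) (c : ℂ) (φ : L2 R2) :
    tensor ψ (c • φ) = c • tensor ψ φ := by
  ext1
  filter_upwards [(memLp_tensor ψ (c • φ)).coeFn_toLp, (memLp_tensor ψ φ).coeFn_toLp,
    Lp.coeFn_smul c (tensor ψ φ),
    (Measure.quasiMeasurePreserving_snd.comp measurePreserving_split.quasiMeasurePreserving).ae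
      (Lp.coeFn_smul c φ)] with x h1 h2 h3 h4
  rw [h3, Pi.smul_apply, tensor, tensor, h1, h2]
  simp only [Function.comp_apply, Pi.smul_apply, smul_eq_mul] at h4 ⊢
  rw [h4]
  ring

/-- The bounded operator `φ ↦ ψ ⊗ φ`. -/
def tensorL (ψ : L2 ℝ) : L2 R2 →L[ℂ] L2 R3 :=
  LinearMap.mkContinuous
    { toFun := tensor ψ
      map_add' := tensor_add ψ
      map_smul' := tensor_smul ψ }
    ‖ψ‖ (fun φ => (norm_tensor ψ φ).le)

/-- The operator `P_ψ ⊗ σ` on `L²(ℝ³)`, where `P_ψ = |ψ⟩⟨ψ|` and `σ` acts on `L²(ℝ²)`. -/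
def pureTensor (ψ : L2 ℝ) (σ : L2 R2 →L[ℂ] L2 R2) : L2 R3 →L[ℂ] L2 R3 :=
  tensorL ψ ∘L σ ∘L ContinuousLinearMap.adjoint (tensorL ψ)

theorem pureTensor_tensor (ψ : L2 ℝ) (σ : L2 R2 →L[ℂ] L2 R2) (f : L2 ℝ) (g : L2 R2) :
    pureTensor ψ σ (tensor f g) = tensor (inner ℂ ψ f • ψ) (σ g) := by
  have h : ContinuousLinearMap.adjoint (tensorL ψ) (tensor f g) = inner ℂ ψ f • g := by
    refine ext_inner_left ℂ fun v => ?_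
    rw [ContinuousLinearMap.adjoint_inner_right, inner_smul_right]
    exact inner_tensor ψ f v g
  have h' : ∀ c : ℂ, tensor (c • ψ) (σ g) = c • tensor ψ (σ g) := by
    intro c
    ext1
    filter_upwards [(memLp_tensor (c • ψ) (σ g)).coeFn_toLp, (memLp_tensor ψ (σ g)).coeFn_toLp,
      Lp.coeFn_smul c (tensor ψ (σ g)),
      (Measure.quasiMeasurePreserving_fst.comp
        measurePreserving_split.quasiMeasurePreserving).ae (Lp.coeFn_smul c ψ)] with x h1 h2 h3 h4
    rw [h3, Pi.smul_apply, tensor, tensor, h1, h2]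
    simp only [Function.comp_apply, Pi.smul_apply, smul_eq_mul] at h4 ⊢
    rw [h4]
    ring
  rw [h', ← tensor_smul, pureTensor, ContinuousLinearMap.comp_apply,
    ContinuousLinearMap.comp_apply, h, map_smul]
  rfl

/-! ### States and observables -/

section Hilbert

variable {H : Type} [NormedAddCommGroup H] [InnerProductSpace ℂ H] [CompleteSpace H]

/-- `T` is trace class with trace `c`: in every orthonormal basis the diagonal matrix elements sum
(unconditionally) to `c`. -/
def HasTrace (T : H →L[ℂ] H) (c : ℂ) : Prop :=
  ∀ (ι : Type) (b : HilbertBasis ι ℂ H), HasSum (fun i => inner ℂ (b i) (T (b i))) c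

/-- A (pure or mixed) state: a positive operator of trace one. -/
def IsDensityOperator (σ : H →L[ℂ] H) : Prop :=
  σ.IsPositive ∧ HasTrace σ 1

end Hilbert

/-- A normalized positive operator valued measure on `Ω`, acting in `H`. It is countably additive
in the weak operator topology; non-measurable sets are assigned the value `0` by convention. -/
structure POVM (Ω : Type) [MeasurableSpace Ω] (H : Type) [NormedAddCommGroup H]
    [InnerProductSpace ℂ H] [CompleteSpace H] where
  /-- The effect that belongs to a set. -/
  effect : Set Ω → (H →L[ℂ] H)
  effect_of_not_measurable : ∀ Z, ¬ MeasurableSet Z → effect Z = 0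
  isPositive : ∀ Z, MeasurableSet Z → (effect Z).IsPositive
  effect_univ : effect Set.univ = 1
  hasSum_iUnion : ∀ Z : ℕ → Set Ω, (∀ n, MeasurableSet (Z n)) →
    Pairwise (Function.onFun Disjoint Z) → ∀ φ ψ : H,
      HasSum (fun n => inner ℂ φ (effect (Z n) ψ)) (inner ℂ φ (effect (⋃ n, Z n) ψ))

/-! ### The model -/

/-- The coordinate directions of system (`0`), first probe (`1`) and second probe (`2`). -/
def dir (i : Fin 3) : R3 := EuclideanSpace.single i 1

/-- The coupling `H = λ Q P₁ - μ P Q₂ + (λμ/2) κ P₁ Q₂`. -/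
def hamiltonian (lam mu κ : ℝ) : 𝓢(R3, ℂ) →L[ℂ] 𝓢(R3, ℂ) :=
  (lam : ℂ) • (positionOp (dir 0) ∘L momentumOp (dir 1))
    - (mu : ℂ) • (momentumOp (dir 0) ∘L positionOp (dir 2))
    + ((lam * mu / 2 * κ : ℝ) : ℂ) • (momentumOp (dir 1) ∘L positionOp (dir 2))

/-- The coupling unitary `U = exp(-iH)`. -/
def coupling (lam mu κ : ℝ) : L2 R3 →L[ℂ] L2 R3 := expNegI (hamiltonian lam mu κ)

/-- The phase space translation `W_{qp} = exp(-i(qP - pQ))` on the system. -/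
def weyl (q p : ℝ) : L2 ℝ →L[ℂ] L2 ℝ :=
  expNegI ((q : ℂ) • momentumOp (1 : ℝ) - (p : ℂ) • positionOp (1 : ℝ))

/-- The pointer projection `I ⊗ E^{Q₁}(X) ⊗ E^{P₂}(Y)`, as the product of the commuting spectral
projections of `Q₁` and `P₂` on `L²(ℝ³)`. -/
def pointer (X Y : Set ℝ) : L2 R3 →L[ℂ] L2 R3 :=
  positionPVM (dir 1) X ∘L momentumPVM (dir 2) Y

/-- `G` is the effective system observable for the probe state `σ`: for every system state
`P_ψ` and all Borel sets `X`, `Y`,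
`tr [U (P_ψ ⊗ σ) U* (I ⊗ E^{Q₁}(λX) ⊗ E^{P₂}(μY))] = ⟨ψ, G(X × Y) ψ⟩`. -/
def IsEffectiveObservable (lam mu κ : ℝ) (σ : L2 R2 →L[ℂ] L2 R2) (G : POVM (ℝ × ℝ) (L2 ℝ)) :
    Prop :=
  ∀ X Y : Set ℝ, MeasurableSet X → MeasurableSet Y → ∀ ψ : L2 ℝ, ‖ψ‖ = 1 →
    HasTrace
      (coupling lam mu κ ∘L pureTensor ψ σ ∘L
        ContinuousLinearMap.adjoint (coupling lam mu κ) ∘L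
        pointer ((fun x => lam * x) '' X) ((fun y => mu * y) '' Y))
      (inner ℂ ψ (G.effect (X ×ˢ Y) ψ))

/-- Covariance under phase space translations: `W_{qp} G(Z) W_{qp}* = G(Z + (q,p))`. -/
def IsCovariant (G : POVM (ℝ × ℝ) (L2 ℝ)) : Prop :=
  ∀ (q p : ℝ) (Z : Set (ℝ × ℝ)), MeasurableSet Z →
    weyl q p ∘L G.effect Z ∘L ContinuousLinearMap.adjoint (weyl q p) =
      G.effect ((fun z => z + (q, p)) '' Z)

end ArthursKelly

end

open MeasureTheory SchwartzMap

noncomputable section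

namespace ArthursKelly

open Filter Topology FourierTransform

/-! ### Weighted composition operators -/

section WeightedComposition

variable {E : Type} [NormedAddCommGroup E] [InnerProductSpace ℝ E] [MeasurableSpace E]
  [BorelSpace E] [FiniteDimensional ℝ E]

/-! In the position representation every unitary of the model is explicit. The factors in each
product of `H` commute, so `-iH` is differentiation along the linear vector field `(μ q₂, -λ q -
(λμκ/2) q₂, 0)`, with no term of order zero. Hence `U` is composition with the time-one map of its
flow, which has determinant one (`coupling_apply`). Similarly `W_{qp}` is a translation times a
unimodular exponential (`weyl_apply`). Since `expNegI` demands uniqueness, both facts need more than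
a candidate group: the candidate preserves Schwartz functions, and then `⟨W t g, V t f⟩` is constant
in `t` for any competitor `W` (`unitaryGroup_unique`).

Existence: write `σ = S²` with `S` self-adjoint and Hilbert–Schmidt, and let `b` be an orthonormal
basis. The trace becomes `∑ᵢ ⟨U(ψ ⊗ S bᵢ), M U(ψ ⊗ S bᵢ)⟩` with `M` the pointer projection. A
Fourier transform `F` in `q₂` alone turns both pointers into coordinate multiplications
(`exists_diagonalize_pointer`), so the projections on rectangles extend to a projection valued
measure `P` on all Borel sets. With `Aᵢ ψ = F U(ψ ⊗ S bᵢ)`, the observable is `G(Z) = ∑ᵢ Aᵢ* P(Z)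
Aᵢ`, and `tr σ = 1` normalizes it.

Uniqueness: expectations in unit vectors determine the effects of rectangles by polarization, and
rectangles form a π-system generating the Borel sets.

Covariance: `U (W_{qp}* ⊗ I) = D U`, where `D` is a phase space displacement of all three degrees of
freedom (`coupling_tensor_adjoint_weyl`). Conjugation by `D` shifts `Q₁` by `λq` and `P₂` by `μp`,
hence the rescaled outcomes by `(q, p)` (`pointer_pointerShift`). Since `D` depends neither on the
probe vector nor on `κ`, the relation passes to every `σ` termwise in the sum. -/

/-- A measure-preserving map together with a unimodular weight, the data of the isometry
`f ↦ phase · (f ∘ map)` of `L²`. -/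
structure PhaseMap (E : Type) [NormedAddCommGroup E] [InnerProductSpace ℝ E] [MeasurableSpace E]
    [BorelSpace E] [FiniteDimensional ℝ E] where
  /-- The unimodular weight. -/
  phase : E → ℂ
  /-- The transformation of the underlying space. -/
  map : E → E
  measurable_phase : Measurable phase
  norm_phase : ∀ x, ‖phase x‖ = 1
  measurePreserving : MeasurePreserving map (volume : Measure E) volume

namespace PhaseMap

theorem memLp (c : PhaseMap E) (f : L2 E) :
    MemLp (fun x => c.phase x * f (c.map x)) 2 (volume : Measure E) := by
  have h := (Lp.memLp f).comp_measurePreserving c.measurePreserving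
  refine h.of_le (c.measurable_phase.aestronglyMeasurable.mul h.1) (Eventually.of_forall ?_)
  intro x
  simp [c.norm_phase]

/-- The isometry `f ↦ phase · (f ∘ map)` of `L²`. -/
def op (c : PhaseMap E) : L2 E →ₗᵢ[ℂ] L2 E where
  toFun f := (c.memLp f).toLp
  map_add' f g := by
    ext1
    filter_upwards [(c.memLp (f + g)).coeFn_toLp, (c.memLp f).coeFn_toLp, (c.memLp g).coeFn_toLp,
      Lp.coeFn_add (c.memLp f).toLp (c.memLp g).toLp,
      c.measurePreserving.quasiMeasurePreserving.ae (Lp.coeFn_add f g)] with x h1 h2 h3 h4 h5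
    rw [h1, h4, Pi.add_apply, h2, h3, h5, Pi.add_apply, mul_add]
  map_smul' k f := by
    ext1
    filter_upwards [(c.memLp (k • f)).coeFn_toLp, (c.memLp f).coeFn_toLp,
      Lp.coeFn_smul k (c.memLp f).toLp,
      c.measurePreserving.quasiMeasurePreserving.ae (Lp.coeFn_smul k f)] with x h1 h2 h3 h4
    rw [h1, RingHom.id_apply, h3, Pi.smul_apply, h2, h4, Pi.smul_apply, smul_eq_mul, smul_eq_mul]
    ring
  norm_map' f := by
    have h := (Lp.memLp f).comp_measurePreserving c.measurePreserving
    change ‖(c.memLp f).toLp‖ = ‖f‖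
    rw [Lp.norm_toLp, Lp.norm_def, ← eLpNorm_comp_measurePreserving (Lp.memLp f).1
      c.measurePreserving]
    congr 1
    refine eLpNorm_congr_norm_ae (Eventually.of_forall fun x => ?_)
    simp [c.norm_phase]

theorem coeFn_op (c : PhaseMap E) (f : L2 E) :
    c.op f =ᵐ[volume] fun x => c.phase x * f (c.map x) :=
  (c.memLp f).coeFn_toLp

theorem op_comp {c d e : PhaseMap E} (hphase : ∀ x, e.phase x = c.phase x * d.phase (c.map x))
    (hmap : ∀ x, e.map x = d.map (c.map x)) (f : L2 E) : e.op f = c.op (d.op f) := by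
  ext1
  filter_upwards [e.coeFn_op f, c.coeFn_op (d.op f),
    c.measurePreserving.quasiMeasurePreserving.ae (d.coeFn_op f)] with x h1 h2 h3
  rw [h1, h2, h3, hphase, hmap, mul_assoc]

theorem op_toLp (c : PhaseMap E) {f : E → ℂ} (hf : MemLp f 2 (volume : Measure E)) :
    c.op hf.toLp =ᵐ[volume] fun x => c.phase x * f (c.map x) := by
  filter_upwards [c.coeFn_op hf.toLp,
    c.measurePreserving.quasiMeasurePreserving.ae hf.coeFn_toLp] with x h1 h2
  rw [h1, h2]

end PhaseMap

theorem coeFn_indicatorOp {s : Set E} (hs : MeasurableSet s) (f : L2 E) :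
    indicatorOp s f =ᵐ[volume] s.indicator f := by
  rw [indicatorOp, dif_pos hs]
  exact ((Lp.memLp f).indicator hs).coeFn_toLp

/-- Composition carries sets back and a scalar weight commutes with multiplication. All
transformation rules for spectral projections below reduce to this. -/
theorem PhaseMap.indicatorOp_op (c : PhaseMap E) {s t : Set E} (ht : MeasurableSet t)
    (h : ∀ x, x ∈ s ↔ c.map x ∈ t) (f : L2 E) :
    indicatorOp s (c.op f) = c.op (indicatorOp t f) := by
  have hs : s = c.map ⁻¹' t := Set.ext h
  have hs' : MeasurableSet s := hs ▸ c.measurePreserving.measurable ht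
  ext1
  filter_upwards [coeFn_indicatorOp hs' (c.op f), c.coeFn_op f, c.coeFn_op (indicatorOp t f),
    c.measurePreserving.quasiMeasurePreserving.ae (coeFn_indicatorOp ht f)] with x h1 h2 h3 h4
  rw [h1, h3, h4]
  by_cases hx : x ∈ s
  · rw [Set.indicator_of_mem hx, Set.indicator_of_mem ((h x).1 hx), h2]
  · rw [Set.indicator_of_notMem hx, Set.indicator_of_notMem (fun h' => hx ((h x).2 h')), mul_zero]

/-! ### Differentiation in `L²` -/

/-- Dominated convergence: the difference quotients minus their pointwise limit are bounded by `2 *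
bound`, whose square is integrable. -/
theorem hasDerivAt_toLp_of_dominated {F : ℝ → E → ℂ} {F' : E → ℂ} {bound : E → ℝ}
    (hF : ∀ t, MemLp (F t) 2 (volume : Measure E)) (hF' : MemLp F' 2 (volume : Measure E))
    (hbound : MemLp bound 2 (volume : Measure E))
    (hderiv : ∀ x, HasDerivAt (fun t => F t x) (F' x) 0)
    (hle : ∀ t : ℝ, |t| ≤ 1 → ∀ x, ‖F t x - F 0 x‖ ≤ |t| * bound x) :
    HasDerivAt (fun t => (hF t).toLp) hF'.toLp 0 := by
  have hb : ∀ x, ‖F' x‖ ≤ bound x := by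
    intro x
    have h := (hasDerivAt_iff_tendsto_slope_zero.1 (hderiv x)).norm
    refine le_of_tendsto h ?_
    have h1 : ∀ᶠ t : ℝ in 𝓝[≠] 0, |t| ≤ 1 := by
      refine nhdsWithin_le_nhds ?_
      filter_upwards [Metric.closedBall_mem_nhds (0 : ℝ) one_pos] with t ht
      simpa using ht
    filter_upwards [h1, self_mem_nhdsWithin] with t ht ht0
    have ht0' : 0 < |t| := abs_pos.2 ht0
    rw [norm_smul, zero_add, norm_inv, Real.norm_eq_abs, inv_mul_le_iff₀ ht0']
    exact hle t ht x
  rw [hasDerivAt_iff_tendsto_slope_zero]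
  have hG : ∀ t : ℝ, MemLp (fun x => t⁻¹ • (F (0 + t) x - F 0 x)) 2 (volume : Measure E) := fun t =>
    ((hF (0 + t)).sub (hF 0)).const_smul t⁻¹
  have heq : ∀ t : ℝ, t⁻¹ • ((hF (0 + t)).toLp - (hF 0).toLp) = (hG t).toLp := by
    intro t
    rw [← MemLp.toLp_sub, ← MemLp.toLp_const_smul]
    rfl
  simp only [heq]
  rw [Lp.tendsto_Lp_iff_tendsto_eLpNorm'' _ hG _ hF']
  have h2 : ∀ g : E → ℂ, eLpNorm g 2 (volume : Measure E) =
      (∫⁻ x, ‖g x‖ₑ ^ (2 : ℝ)) ^ (1 / 2 : ℝ) := by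
    intro g
    rw [eLpNorm_eq_lintegral_rpow_enorm_toReal two_ne_zero ENNReal.ofNat_ne_top]
    simp
  simp only [h2]
  have hzero : (0 : ENNReal) = (∫⁻ _ : E, 0) ^ (1 / 2 : ℝ) := by simp
  rw [hzero]
  refine (ENNReal.continuous_rpow_const.tendsto _).comp ?_
  have hfin : ∫⁻ x, (‖2 * bound x‖ₑ) ^ (2 : ℝ) ∂(volume : Measure E) ≠ ⊤ := by
    have h := (hbound.const_mul 2).2
    rw [eLpNorm_lt_top_iff_lintegral_rpow_enorm_lt_top two_ne_zero ENNReal.ofNat_ne_top] at h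
    simpa using h.ne
  refine tendsto_lintegral_filter_of_dominated_convergence'
    (fun x => (‖2 * bound x‖ₑ) ^ (2 : ℝ)) ?_ ?_ hfin ?_
  · exact Eventually.of_forall fun t => (((hG t).sub hF').1.enorm.pow_const _)
  · have h1 : ∀ᶠ t : ℝ in 𝓝[≠] 0, |t| ≤ 1 := by
      refine nhdsWithin_le_nhds ?_
      filter_upwards [Metric.closedBall_mem_nhds (0 : ℝ) one_pos] with t ht
      simpa using ht
    filter_upwards [h1, self_mem_nhdsWithin] with t ht ht0
    refine Eventually.of_forall fun x => ?_
    gcongr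
    rw [enorm_le_iff_norm_le, Real.norm_eq_abs, Pi.sub_apply]
    refine (norm_sub_le _ _).trans (le_trans ?_ (le_abs_self _))
    have ht0' : 0 < |t| := abs_pos.2 ht0
    have h3 : ‖t⁻¹ • (F (0 + t) x - F 0 x)‖ ≤ bound x := by
      rw [norm_smul, zero_add, norm_inv, Real.norm_eq_abs, inv_mul_le_iff₀ ht0']
      exact hle t ht x
    linarith [hb x]
  · refine Eventually.of_forall fun x => ?_
    have h := (hasDerivAt_iff_tendsto_slope_zero.1 (hderiv x)).sub_const (F' x)
    rw [sub_self] at h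
    have h' := (ENNReal.continuous_rpow_const (y := 2)).continuousAt.tendsto.comp h.enorm
    simpa [Function.comp_def] using h'

/-! ### One-parameter groups -/

theorem denseRange_schwartz_toLp : DenseRange (fun f : 𝓢(E, ℂ) => (f.toLp 2 volume : L2 E)) :=
  SchwartzMap.denseRange_toLpCLM (F := ℂ) (p := 2) (μ := (volume : Measure E))
    ENNReal.ofNat_ne_top

/-- A strongly continuous unitary group that is a candidate for `exp(-itA)` and maps Schwartz
functions to Schwartz functions is the only one whose generator extends `-iA`. -/
theorem unitaryGroup_unique {A : 𝓢(E, ℂ) →L[ℂ] 𝓢(E, ℂ)} {V W : ℝ → (L2 E ≃ₗᵢ[ℂ] L2 E)}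
    (hV : ∀ s t f, V (s + t) f = V s (V t f))
    (hV' : ∀ f : 𝓢(E, ℂ), HasDerivAt (fun t => V t (f.toLp 2 volume))
      ((-Complex.I) • (A f).toLp 2 volume) 0)
    (hS : ∀ t, ∀ f : 𝓢(E, ℂ), ∃ g : 𝓢(E, ℂ), V t (f.toLp 2 volume) = g.toLp 2 volume)
    (hW : ∀ s t f, W (s + t) f = W s (W t f))
    (hW' : ∀ f : 𝓢(E, ℂ), HasDerivAt (fun t => W t (f.toLp 2 volume))
      ((-Complex.I) • (A f).toLp 2 volume) 0) (t : ℝ) (f : L2 E) : W t f = V t f := by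
  have hzero : ∀ {V : ℝ → (L2 E ≃ₗᵢ[ℂ] L2 E)}, (∀ s t f, V (s + t) f = V s (V t f)) →
      ∀ f, V 0 f = f := by
    intro V hV f
    have h := hV 0 0 f
    rw [add_zero] at h
    exact ((V 0).injective h).symm
  have hderiv : ∀ {V : ℝ → (L2 E ≃ₗᵢ[ℂ] L2 E)}, (∀ s t f, V (s + t) f = V s (V t f)) →
      (∀ f : 𝓢(E, ℂ), HasDerivAt (fun t => V t (f.toLp 2 volume))
        ((-Complex.I) • (A f).toLp 2 volume) 0) → ∀ (f : 𝓢(E, ℂ)) (t : ℝ),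
      HasDerivAt (fun t => V t (f.toLp 2 volume)) (V t ((-Complex.I) • (A f).toLp 2 volume)) t := by
    intro V hV hV' f t
    have h1 : HasDerivAt (fun s => V s (f.toLp 2 volume))
        ((-Complex.I) • (A f).toLp 2 volume) (t - t) := by simpa using hV' f
    have h2 := ((V t).toContinuousLinearEquiv.toContinuousLinearMap.restrictScalars
      ℝ).hasFDerivAt.comp_hasDerivAt t (h1.comp_sub_const t t)
    refine h2.congr_of_eventuallyEq (Eventually.of_forall fun s => ?_)
    have := hV t (s - t) (f.toLp 2 volume)
    rw [add_sub_cancel] at this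
    exact this
  have hinner : ∀ {V : ℝ → (L2 E ≃ₗᵢ[ℂ] L2 E)}, (∀ s t f, V (s + t) f = V s (V t f)) →
      ∀ s f g, inner ℂ (V s f) g = inner ℂ f (V (-s) g) := by
    intro V hV s f g
    rw [← (V s).inner_map_map f, ← hV, add_neg_cancel, hzero hV]
  -- No symmetry of `A` is assumed. With `h = V t f` Schwartz, the derivative is `⟨W t g, -iAh⟩ + ⟨W
  -- t (-iAg), h⟩`; differentiating `⟨W s g, h⟩ = ⟨g, W (-s) h⟩` at `s = t` in both forms shows that
  -- the two terms cancel.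
  have hkey : ∀ (f g : 𝓢(E, ℂ)) (t : ℝ),
      HasDerivAt (fun t => inner ℂ (W t (g.toLp 2 volume)) (V t (f.toLp 2 volume))) 0 t := by
    intro f g t
    obtain ⟨h, hh⟩ := hS t f
    have h1 := (hderiv hW hW' g t).inner ℂ (hderiv hV hV' f t)
    refine h1.congr_deriv ?_
    have hVd : V t ((-Complex.I) • (A f).toLp 2 volume) = (-Complex.I) • (A h).toLp 2 volume := by
      have h2 := hderiv hV hV' f t
      have h3 : HasDerivAt (fun s => V s (h.toLp 2 volume)) ((-Complex.I) • (A h).toLp 2 volume)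
        (t - t) := by simpa using hV' h
      have h4 := h3.comp_sub_const t t
      refine h2.unique (h4.congr_of_eventuallyEq (Eventually.of_forall fun s => ?_))
      have := hV (s - t) t (f.toLp 2 volume)
      rw [sub_add_cancel, hh] at this
      exact this
    rw [hVd, hh]
    have hleft := (hderiv hW hW' g t).inner ℂ (hasDerivAt_const t (h.toLp 2 volume))
    have hright := (hasDerivAt_const t (g.toLp 2 volume)).inner ℂ
      ((hderiv hW hW' h (-t)).scomp t (hasDerivAt_neg t))
    have h5 := hleft.unique (hright.congr_of_eventuallyEq
      (Eventually.of_forall fun s => hinner hW s _ _))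
    simp only [inner_zero_right, zero_add, inner_zero_left, add_zero, Function.comp_apply] at h5
    rw [h5, neg_smul (1 : ℝ), one_smul ℝ, inner_neg_right, ← hinner hW, add_neg_cancel]
  have hconst : ∀ (f g : 𝓢(E, ℂ)) (t : ℝ),
      inner ℂ (W t (g.toLp 2 volume)) (V t (f.toLp 2 volume)) =
        inner ℂ (g.toLp 2 volume) (f.toLp 2 volume) := by
    intro f g t
    have h := is_const_of_deriv_eq_zero (𝕜 := ℝ)
      (f := fun t => inner ℂ (W t (g.toLp 2 volume)) (V t (f.toLp 2 volume)))
      (fun t => (hkey f g t).differentiableAt) (fun t => (hkey f g t).deriv) t 0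
    simpa only [hzero hV, hzero hW] using h
  have hall : ∀ (f g : L2 E), inner ℂ (W t g) (V t f) = inner ℂ g f := by
    intro f g
    refine denseRange_schwartz_toLp.induction_on₂ (p := fun f g => inner ℂ (W t g) (V t f) = inner ℂ g f) ?_
      (fun f g => hconst f g t) f g
    have h1 : Continuous fun x : L2 E × L2 E => W t x.2 := (W t).continuous.comp continuous_snd
    have h2 : Continuous fun x : L2 E × L2 E => V t x.1 := (V t).continuous.comp continuous_fst
    exact isClosed_eq (h1.inner h2) (continuous_snd.inner continuous_fst)
  refine ext_inner_left ℂ fun v => ?_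
  obtain ⟨w, rfl⟩ := (W t).surjective v
  rw [(W t).inner_map_map, hall]

/-- Strong continuity need not be assumed: differentiability on the dense Schwartz vectors and
isometry give continuity at `0`, and the group law moves it to every time. -/
theorem expNegI_eq {A : 𝓢(E, ℂ) →L[ℂ] 𝓢(E, ℂ)} {V : ℝ → (L2 E ≃ₗᵢ[ℂ] L2 E)}
    (hV : ∀ s t f, V (s + t) f = V s (V t f))
    (hV' : ∀ f : 𝓢(E, ℂ), HasDerivAt (fun t => V t (f.toLp 2 volume))
      ((-Complex.I) • (A f).toLp 2 volume) 0)
    (hS : ∀ t, ∀ f : 𝓢(E, ℂ), ∃ g : 𝓢(E, ℂ), V t (f.toLp 2 volume) = g.toLp 2 volume)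
    (f : L2 E) : expNegI A f = V 1 f := by
  have hzero : ∀ f, V 0 f = f := by
    intro f
    have h := hV 0 0 f
    rw [add_zero] at h
    exact ((V 0).injective h).symm
  have hcont0 : ∀ f : L2 E, ContinuousAt (fun t => V t f) 0 := by
    intro f
    rw [Metric.continuousAt_iff]
    intro ε hε
    obtain ⟨g, hg⟩ := denseRange_schwartz_toLp.exists_dist_lt f (show 0 < ε / 3 by positivity)
    obtain ⟨δ, hδ, h⟩ := Metric.continuousAt_iff.1 (hV' g).continuousAt (ε / 3) (by positivity)
    refine ⟨δ, hδ, fun {t} ht => ?_⟩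
    have h1 := h ht
    rw [hzero] at h1 ⊢
    have h2 : dist (V t f) (V t (g.toLp 2 volume)) < ε / 3 := by
      rwa [(V t).dist_map]
    rw [dist_comm] at hg
    linarith [dist_triangle4 (V t f) (V t (g.toLp 2 volume)) (g.toLp 2 volume) f]
  have hcont : ∀ f : L2 E, Continuous fun t => V t f := by
    intro f
    refine continuous_iff_continuousAt.2 fun t => ?_
    have h1 : ContinuousAt (fun s => V t (V (s - t) f)) t := by
      refine (V t).continuous.continuousAt.comp ?_
      have h2 : ContinuousAt (fun t => V t f) (t - t) := by simpa using hcont0 f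
      exact h2.comp (f := fun s => s - t) (by fun_prop)
    refine h1.congr (Eventually.of_forall fun s => ?_)
    change V t (V (s - t) f) = V s f
    rw [← hV, add_sub_cancel]
  have hex : IsExpNegI A ((V 1).toContinuousLinearEquiv : L2 E →L[ℂ] L2 E) :=
    ⟨V, hV, hcont, hV', fun f => rfl⟩
  have huniq : ∀ U, IsExpNegI A U → U = ((V 1).toContinuousLinearEquiv : L2 E →L[ℂ] L2 E) := by
    rintro U ⟨W, hW, -, hW', hU⟩
    ext1 f
    rw [hU]
    exact unitaryGroup_unique hV hV' hS hW hW' 1 f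
  have h : ∃! U, IsExpNegI A U := ⟨_, hex, huniq⟩
  rw [expNegI, dif_pos h, huniq _ h.choose_spec.1]
  rfl

/-- A one-parameter group of weighted composition operators. -/
structure PhaseFlow (E : Type) [NormedAddCommGroup E] [InnerProductSpace ℝ E] [MeasurableSpace E]
    [BorelSpace E] [FiniteDimensional ℝ E] where
  /-- The weighted composition at a given time. -/
  at_ : ℝ → PhaseMap E
  phase_add : ∀ s t x, (at_ (s + t)).phase x = (at_ s).phase x * (at_ t).phase ((at_ s).map x)
  map_add : ∀ s t x, (at_ (s + t)).map x = (at_ t).map ((at_ s).map x)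
  map_zero : ∀ x, (at_ 0).map x = x
  norm_le : ∃ K : ℝ, ∀ t : ℝ, |t| ≤ 1 → ∀ x, 1 + ‖x‖ ≤ K * (1 + ‖(at_ t).map x‖)

namespace PhaseFlow

variable (F : PhaseFlow E)

theorem op_add (s t : ℝ) (f : L2 E) :
    (F.at_ (s + t)).op f = (F.at_ s).op ((F.at_ t).op f) :=
  PhaseMap.op_comp (F.phase_add s t) (F.map_add s t) f

theorem op_zero (f : L2 E) : (F.at_ 0).op f = f := by
  have h := F.op_add 0 0 f
  rw [add_zero] at h
  exact ((F.at_ 0).op.injective h).symm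

/-- The unitary group of a flow. -/
def unitary (t : ℝ) : L2 E ≃ₗᵢ[ℂ] L2 E where
  toLinearEquiv := LinearEquiv.ofLinearMap (F.at_ t).op.toLinearMap (F.at_ (-t)).op.toLinearMap
    (by
      ext1 f
      change (F.at_ t).op ((F.at_ (-t)).op f) = f
      rw [← op_add, add_neg_cancel, op_zero])
    (by
      ext1 f
      change (F.at_ (-t)).op ((F.at_ t).op f) = f
      rw [← op_add, neg_add_cancel, op_zero])
  norm_map' := (F.at_ t).op.norm_map

/-- Schwartz decay of order `dim E + 1` is square integrable, and `norm_le` lets it survive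
composition with the flow, uniformly for `|t| ≤ 1`. -/
theorem exists_bound (g : 𝓢(E, ℂ)) : ∃ bound : E → ℝ, MemLp bound 2 (volume : Measure E) ∧
    ∀ t : ℝ, |t| ≤ 1 → ∀ x, ‖g ((F.at_ t).map x)‖ ≤ bound x := by
  obtain ⟨K, hK⟩ := F.norm_le
  set n : ℕ := Module.finrank ℝ E + 1 with hn
  obtain ⟨C, hC0, hC⟩ : ∃ C : ℝ, 0 ≤ C ∧ ∀ x, (1 + ‖x‖) ^ n * ‖g x‖ ≤ C := by
    have h := fun x => SchwartzMap.one_add_le_sup_seminorm_apply (𝕜 := ℂ) (m := (n, 0)) (k := n)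
      (n := 0) le_rfl le_rfl g x
    simp only [norm_iteratedFDeriv_zero] at h
    exact ⟨_, le_trans (by positivity) (h 0), h⟩
  have hK0 : 0 < K := by
    have h := hK 0 (by simp) 0
    rw [F.map_zero] at h
    simp only [norm_zero, add_zero, mul_one] at h
    linarith
  refine ⟨fun x => C * K ^ n * ((1 + ‖x‖) ^ n)⁻¹, ?_, ?_⟩
  · have hmeas : AEStronglyMeasurable (fun x : E => ((1 + ‖x‖) ^ n)⁻¹) volume := by
      refine Continuous.aestronglyMeasurable ?_
      refine Continuous.inv₀ (by fun_prop) fun x => ?_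
      positivity
    refine MemLp.const_mul ?_ _
    rw [memLp_two_iff_integrable_sq_norm hmeas]
    have hint : Integrable (fun x : E => (1 + ‖x‖) ^ (-(n : ℝ))) volume :=
      integrable_one_add_norm (by rw [hn]; push_cast; linarith)
    refine hint.mono' (hmeas.norm.pow 2) (Eventually.of_forall fun x => ?_)
    have h1 : (1 : ℝ) ≤ (1 + ‖x‖) ^ n := one_le_pow₀ (by linarith [norm_nonneg x])
    rw [Real.rpow_neg (by positivity), Real.rpow_natCast, norm_pow, norm_norm, norm_inv,
      Real.norm_of_nonneg (by positivity), sq]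
    exact mul_le_of_le_one_left (by positivity) (inv_le_one_of_one_le₀ h1)
  · intro t ht x
    have h1 := hC ((F.at_ t).map x)
    have h2 : (1 + ‖x‖) ^ n ≤ K ^ n * (1 + ‖(F.at_ t).map x‖) ^ n := by
      rw [← mul_pow]
      exact pow_le_pow_left₀ (by positivity) (hK t ht x) n
    have h3 : 0 < (1 + ‖x‖) ^ n := by positivity
    beta_reduce
    rw [← div_eq_mul_inv, le_div_iff₀ h3]
    calc ‖g ((F.at_ t).map x)‖ * (1 + ‖x‖) ^ n
        ≤ ‖g ((F.at_ t).map x)‖ * (K ^ n * (1 + ‖(F.at_ t).map x‖) ^ n) := by gcongr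
      _ = K ^ n * ((1 + ‖(F.at_ t).map x‖) ^ n * ‖g ((F.at_ t).map x)‖) := by ring
      _ ≤ K ^ n * C := by gcongr
      _ = C * K ^ n := by ring

/-- If differentiating the flow at time zero yields `-iA`, then `exp(-iA)` is the weighted
composition at time one. -/
theorem expNegI_eq_op {A : 𝓢(E, ℂ) →L[ℂ] 𝓢(E, ℂ)}
    (hS : ∀ t, ∀ f : 𝓢(E, ℂ), ∃ g : 𝓢(E, ℂ), ∀ x,
      g x = (F.at_ t).phase x * f ((F.at_ t).map x))
    (hA : ∀ (f : 𝓢(E, ℂ)) (x : E), HasDerivAt (fun t => (F.at_ t).phase x * f ((F.at_ t).map x))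
      (-Complex.I * A f x) 0) (f : L2 E) : expNegI A f = (F.at_ 1).op f := by
  have hop : ∀ t, ∀ f g : 𝓢(E, ℂ), (∀ x, g x = (F.at_ t).phase x * f ((F.at_ t).map x)) →
      F.unitary t (f.toLp 2 volume) = g.toLp 2 volume := by
    intro t f g hg
    ext1
    filter_upwards [(F.at_ t).op_toLp (f.memLp 2 volume), g.coeFn_toLp 2 volume] with x h1 h2
    rw [h2, hg]
    exact h1
  refine expNegI_eq (V := F.unitary) F.op_add ?_ ?_ f
  · intro f
    choose g hg using fun t => hS t f
    obtain ⟨bound, hbound, hle⟩ := F.exists_bound (A f)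
    have hderiv : ∀ x, HasDerivAt (fun t => g t x) (((-Complex.I) • A f) x) 0 := by
      intro x
      simp only [hg]
      exact hA f x
    -- The group law transports the derivative at `0` to time `s`. Its modulus is that of `A f` at
    -- the moved point, so the mean value inequality yields the domination required for the `L²`
    -- derivative.
    have hderiv' : ∀ x s, HasDerivAt (fun t => g t x)
        ((F.at_ s).phase x * (((-Complex.I) • A f) ((F.at_ s).map x))) s := by
      intro x s
      have h1 : HasDerivAt (fun t => g t ((F.at_ s).map x))
        (((-Complex.I) • A f) ((F.at_ s).map x)) (s - s) := by
        rw [sub_self]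
        exact hderiv _
      refine ((h1.comp_sub_const s s).const_mul ((F.at_ s).phase x)).congr_of_eventuallyEq
        (Eventually.of_forall fun t => ?_)
      have h2 := F.phase_add s (t - s) x
      have h3 := F.map_add s (t - s) x
      rw [add_sub_cancel] at h2 h3
      simp only [hg, h2, h3, mul_assoc]
    have h := hasDerivAt_toLp_of_dominated (F := fun t x => g t x)
      (F' := fun x => ((-Complex.I) • A f) x) (bound := bound)
      (fun t => (g t).memLp 2 volume) (((-Complex.I) • A f).memLp 2 volume) hbound hderiv ?_
    · have h' : (-Complex.I) • (A f).toLp 2 volume =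
        (((-Complex.I) • A f).memLp 2 volume).toLp := rfl
      rw [h']
      refine h.congr_of_eventuallyEq (Eventually.of_forall fun t => ?_)
      exact hop t f (g t) (hg t)
    · intro t ht x
      have h1 := (convex_uIcc 0 t).norm_image_sub_le_of_norm_hasDerivWithin_le (f := fun t => g t x)
        (C := bound x) (fun s _ => (hderiv' x s).hasDerivWithinAt) ?_ Set.left_mem_uIcc
        Set.right_mem_uIcc
      · rw [sub_zero, Real.norm_eq_abs, mul_comm] at h1
        exact h1
      · intro s hs
        have hs1 : |s| ≤ 1 := by
          have := Set.abs_sub_left_of_mem_uIcc hs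
          simp only [sub_zero] at this
          exact this.trans ht
        rw [norm_mul, (F.at_ s).norm_phase, one_mul]
        simpa using hle s hs1 x
  · intro t f
    obtain ⟨g, hg⟩ := hS t f
    exact ⟨g, hop t f g hg⟩

end PhaseFlow

end WeightedComposition

/-! ### Phase space translations -/

/-- Each derivative is a constant times a unimodular function. This makes multiplication by the
exponential preserve Schwartz functions. -/
theorem hasTemperateGrowth_cexp_mul_I (a : ℝ) :
    Function.HasTemperateGrowth (fun x : ℝ => Complex.exp (Complex.I * (a * x))) := by
  have hd : ∀ (n : ℕ) (x : ℝ), iteratedDeriv n (fun x : ℝ => Complex.exp (Complex.I * (a * x))) x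
      = (Complex.I * a) ^ n * Complex.exp (Complex.I * (a * x)) := by
    intro n
    induction n with
    | zero => simp
    | succ n ih =>
      intro x
      rw [iteratedDeriv_succ, funext ih]
      have h : HasDerivAt (fun x : ℝ => Complex.exp (Complex.I * (a * x)))
          (Complex.exp (Complex.I * (a * x)) * (Complex.I * (a * 1))) x :=
        ((((hasDerivAt_id x).ofReal_comp).const_mul (a : ℂ)).const_mul Complex.I).cexp
      rw [(h.const_mul _).deriv]
      ring
  refine ⟨?_, fun n => ⟨0, |a| ^ n, fun x => ?_⟩⟩
  · exact (contDiff_const.mul (contDiff_const.mul Complex.ofRealCLM.contDiff)).cexp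
  · rw [norm_iteratedFDeriv_eq_norm_iteratedDeriv, hd]
    have : ‖Complex.exp (Complex.I * (a * x))‖ = 1 := by
      rw [mul_comm, ← Complex.ofReal_mul, Complex.norm_exp_ofReal_mul_I]
    simp [this]

/-- The group `exp(-it(qP - pQ))`. -/
def weylFlow (q p : ℝ) : PhaseFlow ℝ where
  at_ t :=
    -- The exponent is the integral of `p (x - s q)` over `s` from `0` to `t`; the quadratic term is
    -- what makes the weights a cocycle.
    { phase := fun x => Complex.exp (Complex.I * ((p * (t * x - q * t ^ 2 / 2) : ℝ) : ℂ))
      map := fun x => x - t * q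
      measurable_phase := by fun_prop
      norm_phase := fun x => by rw [mul_comm, Complex.norm_exp_ofReal_mul_I]
      measurePreserving := measurePreserving_sub_right volume (t * q) }
  phase_add s t x := by
    rw [← Complex.exp_add]
    push_cast
    ring_nf
  map_add s t x := by ring
  map_zero x := by simp
  norm_le := by
    refine ⟨1 + |q|, fun t ht x => ?_⟩
    simp only [Real.norm_eq_abs]
    have h1 : |x| ≤ |x - t * q| + |t * q| := by
      simpa using abs_add_le (x - t * q) (t * q)
    have h2 : |t * q| ≤ |q| := by
      rw [abs_mul]
      exact mul_le_of_le_one_left (abs_nonneg q) ht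
    nlinarith [abs_nonneg q, abs_nonneg (x - t * q), mul_nonneg (abs_nonneg q) (abs_nonneg (x - t * q))]

theorem weyl_apply (q p : ℝ) (f : L2 ℝ) : weyl q p f = ((weylFlow q p).at_ 1).op f := by
  refine (weylFlow q p).expNegI_eq_op ?_ ?_ f
  · intro t f
    refine ⟨smulLeftCLM ℂ (fun x : ℝ => Complex.exp (Complex.I * ((p * t : ℝ) * x)))
      (Complex.exp (Complex.I * ((-(p * (q * t ^ 2 / 2)) : ℝ) : ℂ)) •
        compSubConstCLM ℂ (t * q) f), fun x => ?_⟩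
    rw [smulLeftCLM_apply_apply (hasTemperateGrowth_cexp_mul_I (p * t))]
    simp only [weylFlow, smul_apply, compSubConstCLM_apply, smul_eq_mul, ← mul_assoc,
      ← Complex.exp_add]
    congr 2
    push_cast
    ring
  · intro f x
    have h1 : HasDerivAt (fun t : ℝ => Complex.exp (Complex.I * ((p * (t * x - q * t ^ 2 / 2) : ℝ) : ℂ)))
        (Complex.exp (Complex.I * ((p * (0 * x - q * 0 ^ 2 / 2) : ℝ) : ℂ)) *
          (Complex.I * ((p * (1 * x - q * (2 * 0) / 2) : ℝ) : ℂ))) 0 := by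
      have h := (((hasDerivAt_id (0 : ℝ)).mul_const x).sub
        (((hasDerivAt_pow 2 (0 : ℝ)).const_mul q).div_const 2)).const_mul p
      have h' := (h.ofReal_comp.const_mul Complex.I).cexp
      simpa using h'
    have h2 : HasDerivAt (fun t : ℝ => f (x - t * q)) (-(1 * q) • deriv f (x - 0 * q)) 0 :=
      (f.hasDerivAt (x - 0 * q)).scomp 0 (((hasDerivAt_id (0 : ℝ)).mul_const q).const_sub x)
    have h3 := h1.mul h2
    simp only [weylFlow]
    refine h3.congr_deriv ?_
    have h4 : lineDeriv ℝ f x 1 = deriv f x := by simp [lineDeriv, deriv_comp_const_add]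
    have h5 : inner ℝ (1 : ℝ) x = x := by simp
    simp only [_root_.sub_apply, _root_.smul_apply, momentumOp_apply, positionOp_apply, h4, h5]
    simp
    ring_nf
    simp
    ring

/-! ### The coupling -/

/-- The flow of the vector field `(μ q₂, -λ q - (λμκ/2) q₂, 0)`. -/
def couplingMap (lam mu κ t : ℝ) : R3 →ₗ[ℝ] R3 where
  toFun x := !₂[x 0 + t * mu * x 2,
    -- The `t ^ 2` term arises because the first coordinate itself moves: it is the integral of `lam
    -- * (s * mu * x 2)` over `s` from `0` to `t`.
    x 1 - t * lam * x 0 - (t * (lam * mu / 2 * κ) + t ^ 2 * (lam * mu / 2)) * x 2, x 2]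
  map_add' x y := by
    ext i
    fin_cases i <;> simp <;> ring
  map_smul' c x := by
    ext i
    fin_cases i <;> simp <;> ring

theorem couplingMap_apply (lam mu κ t : ℝ) (x : R3) : couplingMap lam mu κ t x =
    !₂[x 0 + t * mu * x 2,
    x 1 - t * lam * x 0 - (t * (lam * mu / 2 * κ) + t ^ 2 * (lam * mu / 2)) * x 2, x 2] := rfl

theorem couplingMap_add (lam mu κ s t : ℝ) (x : R3) :
    couplingMap lam mu κ (s + t) x = couplingMap lam mu κ t (couplingMap lam mu κ s x) := by
  ext i
  fin_cases i <;> simp [couplingMap_apply] <;> ring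

theorem couplingMap_zero (lam mu κ : ℝ) (x : R3) : couplingMap lam mu κ 0 x = x := by
  ext i
  fin_cases i <;> simp [couplingMap_apply]

theorem det_couplingMap (lam mu κ t : ℝ) : LinearMap.det (couplingMap lam mu κ t) = 1 := by
  rw [← LinearMap.det_toMatrix (EuclideanSpace.basisFun (Fin 3) ℝ).toBasis, Matrix.det_fin_three]
  simp [LinearMap.toMatrix_apply, couplingMap_apply]

theorem measurePreserving_couplingMap (lam mu κ t : ℝ) :
    MeasurePreserving (couplingMap lam mu κ t) (volume : Measure R3) volume := by
  refine ⟨(couplingMap lam mu κ t).continuous_of_finiteDimensional.measurable, ?_⟩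
  rw [Measure.map_linearMap_addHaar_eq_smul_addHaar _ (by rw [det_couplingMap]; exact one_ne_zero),
    det_couplingMap]
  simp

/-- `couplingMap` as a continuous linear equivalence. -/
def couplingEquiv (lam mu κ t : ℝ) : R3 ≃L[ℝ] R3 :=
  (LinearEquiv.ofLinearMap (couplingMap lam mu κ t) (couplingMap lam mu κ (-t))
    (by
      ext1 x
      change couplingMap lam mu κ t (couplingMap lam mu κ (-t) x) = x
      rw [← couplingMap_add, neg_add_cancel, couplingMap_zero])
    (by
      ext1 x
      change couplingMap lam mu κ (-t) (couplingMap lam mu κ t x) = x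
      rw [← couplingMap_add, add_neg_cancel, couplingMap_zero])).toContinuousLinearEquiv

/-- The map is a quadratic polynomial in `t` with value the identity at `0`; its linear and
quadratic coefficients `B` and `D` are recovered from the values at `t = ±1`. -/
theorem norm_couplingMap_le (lam mu κ : ℝ) : ∃ C : ℝ, 0 ≤ C ∧ ∀ t : ℝ, |t| ≤ 1 → ∀ x,
    ‖couplingMap lam mu κ t x‖ ≤ C * ‖x‖ := by
  set B : R3 →ₗ[ℝ] R3 := (2⁻¹ : ℝ) • (couplingMap lam mu κ 1 - couplingMap lam mu κ (-1)) with hB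
  set D : R3 →ₗ[ℝ] R3 := (2⁻¹ : ℝ) • (couplingMap lam mu κ 1 + couplingMap lam mu κ (-1)) -
    LinearMap.id with hD
  have hx : ∀ t x, couplingMap lam mu κ t x = x + t • B x + t ^ 2 • D x := by
    intro t x
    ext i
    fin_cases i
    · simp [couplingMap_apply, hB, hD]
      ring
    · simp [couplingMap_apply, hB, hD]
      ring
    · simp [couplingMap_apply, hB, hD]
      right
      ring
  refine ⟨1 + ‖B.toContinuousLinearMap‖ + ‖D.toContinuousLinearMap‖, by positivity,
    fun t ht x => ?_⟩
  have h1 : ‖B x‖ ≤ ‖B.toContinuousLinearMap‖ * ‖x‖ := B.toContinuousLinearMap.le_opNorm x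
  have h2 : ‖D x‖ ≤ ‖D.toContinuousLinearMap‖ * ‖x‖ := D.toContinuousLinearMap.le_opNorm x
  have h3 : ‖t • B x‖ ≤ ‖B x‖ := by
    rw [norm_smul]
    exact mul_le_of_le_one_left (norm_nonneg _) ht
  have h4 : ‖t ^ 2 • D x‖ ≤ ‖D x‖ := by
    rw [norm_smul, norm_pow]
    exact mul_le_of_le_one_left (norm_nonneg _) (pow_le_one₀ (norm_nonneg _) ht)
  rw [hx]
  refine (norm_add₃_le).trans ?_
  linarith

/-- The group `exp(-itH)` of the coupling. -/
def couplingFlow (lam mu κ : ℝ) : PhaseFlow R3 where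
  at_ t :=
    { phase := fun _ => 1
      map := couplingMap lam mu κ t
      measurable_phase := measurable_const
      norm_phase := fun _ => norm_one
      measurePreserving := measurePreserving_couplingMap lam mu κ t }
  phase_add _ _ _ := (mul_one 1).symm
  map_add s t x := couplingMap_add lam mu κ s t x
  map_zero x := couplingMap_zero lam mu κ x
  norm_le := by
    obtain ⟨C, hC0, hC⟩ := norm_couplingMap_le lam mu κ
    refine ⟨1 + C, fun t ht x => ?_⟩
    -- The required lower bound on the flow is the upper bound for its inverse, the flow at time
    -- `-t`.
    have h := hC (-t) (by rwa [abs_neg]) (couplingMap lam mu κ t x)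
    rw [← couplingMap_add, add_neg_cancel, couplingMap_zero] at h
    nlinarith [norm_nonneg (couplingMap lam mu κ t x)]

/-- By the chain rule the time derivative at `0` of `f` along the flow is the derivative of `f`
along the vector field, which is `-iHf`. -/
theorem coupling_apply (lam mu κ : ℝ) (f : L2 R3) :
    coupling lam mu κ f = ((couplingFlow lam mu κ).at_ 1).op f := by
  refine (couplingFlow lam mu κ).expNegI_eq_op ?_ ?_ f
  · intro t f
    exact ⟨compCLMOfContinuousLinearEquiv ℂ (couplingEquiv lam mu κ t) f, fun x =>
      (one_mul _).symm⟩
  · intro f x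
    have hm : HasDerivAt (fun t => couplingMap lam mu κ t x)
        ((mu * x 2) • dir 0 - (lam * x 0 + lam * mu / 2 * κ * x 2) • dir 1) 0 := by
      have h : (fun t => couplingMap lam mu κ t x) = fun t : ℝ => x + t • ((mu * x 2) • dir 0 -
          (lam * x 0 + lam * mu / 2 * κ * x 2) • dir 1) -
          t ^ 2 • ((lam * mu / 2 * x 2) • dir 1) := by
        funext t
        ext i
        fin_cases i <;> simp [couplingMap_apply, dir] <;> ring
      rw [h]
      have h1 := (((hasDerivAt_id (0 : ℝ)).smul_const ((mu * x 2) • dir 0 -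
          (lam * x 0 + lam * mu / 2 * κ * x 2) • dir 1)).const_add x).sub
          ((hasDerivAt_pow 2 (0 : ℝ)).smul_const ((lam * mu / 2 * x 2) • dir 1))
      exact h1.congr_deriv (by simp)
    have hf : HasFDerivAt f (fderiv ℝ f x) (couplingMap lam mu κ 0 x) := by
      rw [couplingMap_zero]
      exact f.hasFDerivAt x
    have h1 := hf.comp_hasDerivAt 0 hm
    have hl : ∀ v, lineDeriv ℝ f x v = fderiv ℝ f x v := fun v =>
      (f.differentiableAt (x := x)).lineDeriv_eq_fderiv
    -- The coordinate `q₂` is constant along the directions `0` and `1`, so it passes through the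
    -- derivative.
    have hpq : ∀ i : Fin 3, i ≠ 2 →
        momentumOp (dir i) (positionOp (dir 2) f) x = -Complex.I * (x 2 * fderiv ℝ f x (dir i)) := by
      intro i hi
      rw [momentumOp_apply]
      congr 1
      have h : ∀ y : R3, positionOp (dir 2) f y = ((y 2 : ℝ) : ℂ) * f y := by
        intro y
        rw [positionOp_apply]
        simp [dir, EuclideanSpace.inner_single_left]
      rw [lineDeriv, ← hl, lineDeriv]
      simp only [h]
      have h2 : ∀ t : ℝ, (x + t • dir i) 2 = x 2 := by
        intro t
        simp [dir, hi.symm]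
      simp only [h2]
      rw [deriv_const_mul_field]
    have hq : ∀ g : 𝓢(R3, ℂ), positionOp (dir 0) g x = ((x 0 : ℝ) : ℂ) * g x := by
      intro g
      rw [positionOp_apply]
      simp [dir, EuclideanSpace.inner_single_left]
    simp only [couplingFlow, one_mul]
    refine h1.congr_deriv ?_
    simp only [hamiltonian, ContinuousLinearMap.comp_apply, _root_.add_apply,
      _root_.sub_apply, _root_.smul_apply, hpq 0 (by decide), hpq 1 (by decide), hq,
      momentumOp_apply, hl, map_sub, map_smul]
    simp only [Complex.real_smul, smul_eq_mul]
    push_cast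
    linear_combination (mu * x 2 * fderiv ℝ f x (dir 0) - (lam * x 0 + lam * mu / 2 * κ * x 2)
      * fderiv ℝ f x (dir 1)) * Complex.I_mul_I

/-! ### The Fourier transform on `L²` -/

section Fourier

variable {E : Type} [NormedAddCommGroup E] [InnerProductSpace ℝ E] [MeasurableSpace E]
  [BorelSpace E] [FiniteDimensional ℝ E]

/-- On `L¹ ∩ L²` the `L²` Fourier transform is given by the Fourier integral. -/
theorem fourierTransform_toLp_ae_eq {f : E → ℂ} (h1 : Integrable f (volume : Measure E))
    (h2 : MemLp f 2 (volume : Measure E)) :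
    Lp.fourierTransformₗᵢ E ℂ h2.toLp =ᵐ[volume] 𝓕 f := by
  have hcont : Continuous (𝓕 f) :=
    VectorFourier.fourierIntegral_continuous (L := innerₗ E) Real.continuous_fourierChar
      continuous_inner h1
  refine ae_eq_of_integral_contDiff_smul_eq ((Lp.memLp _).locallyIntegrable one_le_two)
    hcont.locallyIntegrable ?_
  intro g g_smooth g_cpt
  have hg₁ : HasCompactSupport (Complex.ofRealCLM ∘ g) := g_cpt.comp_left rfl
  have hg₂ : ContDiff ℝ (⊤ : ℕ∞) (Complex.ofRealCLM ∘ g) := Complex.ofRealCLM.contDiff.comp g_smooth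
  set φ : 𝓢(E, ℂ) := hg₁.toSchwartzMap hg₂ with hφ
  have hφg : ∀ x, φ x = (g x : ℂ) := fun x => rfl
  -- The `L²` transform agrees with the distributional one, which moves the transform onto `φ`; for
  -- integrable `f` the Fourier integral obeys the same transposition rule (`h5`).
  have h3 : Lp.toTemperedDistribution (𝓕 (h2.toLp : L2 E)) φ =
      Lp.toTemperedDistribution (h2.toLp : L2 E) (𝓕 φ) := by
    rw [← Lp.fourier_toTemperedDistribution_eq]
    rfl
  rw [Lp.toTemperedDistribution_apply, Lp.toTemperedDistribution_apply] at h3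
  have h4 : ∫ x, (𝓕 φ) x • (h2.toLp : L2 E) x = ∫ x, (𝓕 φ) x • f x := by
    refine integral_congr_ae ?_
    filter_upwards [h2.coeFn_toLp] with x hx
    rw [hx]
  have h5 : ∫ ξ, (𝓕 φ) ξ • f ξ = ∫ x, φ x • (𝓕 f) x := by
    simpa using! VectorFourier.integral_fourierIntegral_smul_eq_flip (L := innerₗ E)
      Real.continuous_fourierChar continuous_inner φ.integrable h1
  have h6 := h3.trans (h4.trans h5)
  simp only [hφg] at h6
  simpa using! h6

/-- The weighted translation `f ↦ exp(i(2π⟪w, ·⟫ + θ)) f(· + v)`. -/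
def displacement (θ : ℝ) (v w : E) : PhaseMap E where
  phase x := Complex.exp (((2 * Real.pi * inner ℝ w x + θ : ℝ) : ℂ) * Complex.I)
  map x := x + v
  measurable_phase := by fun_prop
  norm_phase x := Complex.norm_exp_ofReal_mul_I _
  measurePreserving := measurePreserving_add_right volume v

/-- Translation by `v` becomes modulation by `v`, and modulation by `w` becomes translation by `-w`.
The extra phase `-2π⟪v, w⟫` comes from reversing their order. -/
theorem fourierTransform_displacement (θ : ℝ) (v w : E) (f : L2 E) :
    Lp.fourierTransformₗᵢ E ℂ ((displacement θ v w).op f) =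
      (displacement (θ - 2 * Real.pi * inner ℝ v w) (-w) v).op (Lp.fourierTransformₗᵢ E ℂ f) := by
  refine denseRange_schwartz_toLp.induction_on (p := fun f =>
    Lp.fourierTransformₗᵢ E ℂ ((displacement θ v w).op f) =
      (displacement (θ - 2 * Real.pi * inner ℝ v w) (-w) v).op (Lp.fourierTransformₗᵢ E ℂ f)) f
      (isClosed_eq ?_ ?_) ?_
  · exact (Lp.fourierTransformₗᵢ E ℂ).continuous.comp (displacement θ v w).op.continuous
  · exact (LinearIsometry.continuous _).comp (Lp.fourierTransformₗᵢ E ℂ).continuous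
  · intro f
    set c := displacement θ v w with hc
    set g : E → ℂ := fun x => c.phase x * f (c.map x) with hg
    have hgm : MemLp g 2 (volume : Measure E) := by
      have h := (f.memLp 2 (volume : Measure E)).comp_measurePreserving c.measurePreserving
      refine h.of_le (c.measurable_phase.aestronglyMeasurable.mul h.1) (Eventually.of_forall ?_)
      intro x
      simp [hg, c.norm_phase]
    have hgi : Integrable g (volume : Measure E) := by
      have h : Integrable (fun x => f (c.map x)) (volume : Measure E) :=
        (f.integrable (μ := volume)).comp_add_right v
      refine h.mono (c.measurable_phase.aestronglyMeasurable.mul h.1) (Eventually.of_forall ?_)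
      intro x
      simp [hg, c.norm_phase]
    have hop : c.op (f.toLp 2 volume) = hgm.toLp := by
      ext1
      filter_upwards [c.op_toLp (f.memLp 2 volume), hgm.coeFn_toLp] with x h1 h2
      rw [h2]
      exact h1
    rw [hop]
    ext1
    set d := displacement (θ - 2 * Real.pi * inner ℝ v w) (-w) v with hd
    filter_upwards [fourierTransform_toLp_ae_eq hgi hgm,
      d.coeFn_op (Lp.fourierTransformₗᵢ E ℂ (f.toLp 2 volume)),
      d.measurePreserving.quasiMeasurePreserving.ae
        (fourierTransform_toLp_ae_eq (f.integrable (μ := volume)) (f.memLp 2 volume))]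
      with ξ h1 h2 h3
    have h3' : (Lp.fourierTransformₗᵢ E ℂ (f.toLp 2 volume)) (d.map ξ) = 𝓕 (f : E → ℂ) (d.map ξ) :=
      h3
    rw [h1, h2, h3', Real.fourier_eq', Real.fourier_eq', ← integral_const_mul,
      ← integral_add_right_eq_self (fun x => d.phase ξ * (Complex.exp
        (((-2 * Real.pi * inner ℝ x (d.map ξ) : ℝ) : ℂ) * Complex.I) • f x)) v]
    congr 1
    funext x
    simp only [hg, hc, hd, displacement, smul_eq_mul, ← mul_assoc, ← Complex.exp_add]
    congr 2
    rw [← add_mul, ← add_mul, ← Complex.ofReal_add, ← Complex.ofReal_add]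
    congr 2
    simp only [inner_add_left, inner_add_right, inner_neg_right]
    rw [real_inner_comm x w]
    ring

/-- After the Fourier transform only the modulation `w` moves the argument; the translation `v` has
become a phase, which commutes with indicators. For position the roles are exchanged. -/
theorem momentumPVM_displacement (θ : ℝ) (v w e : E) {Y Y' : Set ℝ} (hY' : MeasurableSet Y')
    (h : ∀ y, y ∈ Y ↔ y - 2 * Real.pi * inner ℝ e w ∈ Y') (f : L2 E) :
    momentumPVM e Y ((displacement θ v w).op f) =
      (displacement θ v w).op (momentumPVM e Y' f) := by
  change (Lp.fourierTransformₗᵢ E ℂ).symm (indicatorOp {ξ : E | 2 * Real.pi * inner ℝ e ξ ∈ Y}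
    (Lp.fourierTransformₗᵢ E ℂ ((displacement θ v w).op f))) = (displacement θ v w).op
    ((Lp.fourierTransformₗᵢ E ℂ).symm (indicatorOp {ξ : E | 2 * Real.pi * inner ℝ e ξ ∈ Y'}
    (Lp.fourierTransformₗᵢ E ℂ f)))
  have hm : Measurable fun ξ : E => 2 * Real.pi * inner ℝ e ξ := by fun_prop
  rw [LinearIsometryEquiv.symm_apply_eq, fourierTransform_displacement,
    fourierTransform_displacement, LinearIsometryEquiv.apply_symm_apply]
  refine PhaseMap.indicatorOp_op _ (hm hY') (fun ξ => ?_) _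
  simp only [Set.mem_ofPred_eq, Set.mem_preimage, displacement, inner_add_right, inner_neg_right, h]
  ring_nf

theorem positionPVM_displacement (θ : ℝ) (v w e : E) {X X' : Set ℝ} (hX' : MeasurableSet X')
    (h : ∀ x, x ∈ X ↔ x + inner ℝ e v ∈ X') (f : L2 E) :
    positionPVM e X ((displacement θ v w).op f) =
      (displacement θ v w).op (positionPVM e X' f) := by
  have hm : Measurable fun x : E => inner ℝ e x := by fun_prop
  refine PhaseMap.indicatorOp_op _ (hm hX') (fun ξ => ?_) _
  simp only [Set.mem_ofPred_eq, Set.mem_preimage, displacement, inner_add_right, h]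

end Fourier

/-! ### Separating the momentum pointer -/

/-- The splitting `(q, q₁, q₂) ↦ ((q, q₁), q₂)`. -/
def splitLast : R3 ≃ᵐ R2 × ℝ :=
  ((MeasurableEquiv.toLp 2 (Fin 3 → ℝ)).symm.trans
    (MeasurableEquiv.piFinSuccAbove (fun _ : Fin 3 => ℝ) 2)).trans
    (MeasurableEquiv.prodComm.trans
      (MeasurableEquiv.prodCongr (MeasurableEquiv.toLp 2 (Fin 2 → ℝ)) (MeasurableEquiv.refl ℝ)))

theorem splitLast_apply (x : R3) : splitLast x = (!₂[x 0, x 1], x 2) := by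
  refine Prod.ext ?_ rfl
  ext i
  fin_cases i <;> rfl

theorem measurePreserving_splitLast :
    MeasurePreserving splitLast (volume : Measure R3) volume := by
  have h1 := EuclideanSpace.volume_preserving_symm_measurableEquiv_toLp (Fin 3)
  have h2 := volume_preserving_piFinSuccAbove (fun _ : Fin 3 => ℝ) 2
  have h3 : MeasurePreserving (Prod.map (MeasurableEquiv.toLp 2 (Fin 2 → ℝ)) id)
      (volume : Measure ((Fin 2 → ℝ) × ℝ)) (volume : Measure (R2 × ℝ)) :=
    (EuclideanSpace.volume_preserving_symm_measurableEquiv_toLp (Fin 2)).symm.prod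
      (MeasurePreserving.id volume)
  exact h3.comp (Measure.measurePreserving_swap.comp (h2.comp h1))

theorem ae_splitLast_fst {p : R2 → Prop} (h : ∀ᵐ y, p y) : ∀ᵐ x : R3, p (splitLast x).1 :=
  (Measure.quasiMeasurePreserving_fst.comp
    measurePreserving_splitLast.quasiMeasurePreserving).ae h

theorem ae_splitLast_snd {p : ℝ → Prop} (h : ∀ᵐ y, p y) : ∀ᵐ x : R3, p (splitLast x).2 :=
  (Measure.quasiMeasurePreserving_snd.comp
    measurePreserving_splitLast.quasiMeasurePreserving).ae h

theorem memLp_mul_splitLast {h : R2 → ℂ} {c : ℝ → ℂ} (hh : MemLp h 2 (volume : Measure R2))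
    (hc : MemLp c 2 (volume : Measure ℝ)) :
    MemLp (fun x : R3 => h (splitLast x).1 * c (splitLast x).2) 2 volume := by
  have hm : MemLp (fun z : R2 × ℝ => h z.1 * c z.2) 2 volume := by
    have hae : AEStronglyMeasurable (fun z : R2 × ℝ => h z.1 * c z.2) volume :=
      hh.1.comp_fst.mul hc.1.comp_snd
    rw [memLp_two_iff_integrable_sq_norm hae]
    rw [memLp_two_iff_integrable_sq_norm hh.1] at hh
    rw [memLp_two_iff_integrable_sq_norm hc.1] at hc
    simpa [mul_pow, Measure.volume_eq_prod] using hh.mul_prod hc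
  exact hm.comp_measurePreserving measurePreserving_splitLast

/-- The vector `h ⊗ c` with `(h ⊗ c)(q, q₁, q₂) = h(q, q₁) c(q₂)`. -/
def tensorLast (h : L2 R2) (c : L2 ℝ) : L2 R3 :=
  (memLp_mul_splitLast (Lp.memLp h) (Lp.memLp c)).toLp

theorem coeFn_tensorLast (h : L2 R2) (c : L2 ℝ) :
    tensorLast h c =ᵐ[volume] fun x => h (splitLast x).1 * c (splitLast x).2 :=
  (memLp_mul_splitLast (Lp.memLp h) (Lp.memLp c)).coeFn_toLp

theorem tensorLast_toLp {h : R2 → ℂ} {c : ℝ → ℂ} (hh : MemLp h 2 (volume : Measure R2))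
    (hc : MemLp c 2 (volume : Measure ℝ)) :
    tensorLast hh.toLp hc.toLp = (memLp_mul_splitLast hh hc).toLp := by
  ext1
  filter_upwards [coeFn_tensorLast hh.toLp hc.toLp, (memLp_mul_splitLast hh hc).coeFn_toLp,
    ae_splitLast_fst hh.coeFn_toLp, ae_splitLast_snd hc.coeFn_toLp] with x h1 h2 h3 h4
  rw [h1, h2, h3, h4]

theorem inner_tensorLast (h h' : L2 R2) (c c' : L2 ℝ) :
    inner ℂ (tensorLast h c) (tensorLast h' c') = inner ℂ h h' * inner ℂ c c' := by
  rw [L2.inner_def, L2.inner_def, L2.inner_def, ← integral_prod_mul]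
  have hae : ∀ᵐ x : R3, inner ℂ (tensorLast h c x) (tensorLast h' c' x) =
      (fun z : R2 × ℝ => inner ℂ (h z.1) (h' z.1) * inner ℂ (c z.2) (c' z.2)) (splitLast x) := by
    filter_upwards [coeFn_tensorLast h c, coeFn_tensorLast h' c'] with x h1 h2
    rw [h1, h2]
    simp
    ring
  rw [integral_congr_ae hae, measurePreserving_splitLast.integral_comp'
    (g := fun z : R2 × ℝ => inner ℂ (h z.1) (h' z.1) * inner ℂ (c z.2) (c' z.2))]
  rfl

theorem norm_tensorLast (h : L2 R2) (c : L2 ℝ) : ‖tensorLast h c‖ = ‖h‖ * ‖c‖ := by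
  have H := inner_tensorLast h h c c
  simp only [inner_self_eq_norm_sq_to_K] at H
  have h' : ‖tensorLast h c‖ ^ 2 = (‖h‖ * ‖c‖) ^ 2 := by
    rw [mul_pow]
    exact_mod_cast H
  exact (pow_left_inj₀ (norm_nonneg _) (by positivity) two_ne_zero).1 h'

/-- The tensor product as a bounded bilinear map. -/
def tensorLastL : L2 R2 →L[ℂ] L2 ℝ →L[ℂ] L2 R3 :=
  LinearMap.mkContinuous₂
    (LinearMap.mk₂ ℂ tensorLast
      (by
        intro h h' c
        ext1
        filter_upwards [coeFn_tensorLast (h + h') c, coeFn_tensorLast h c, coeFn_tensorLast h' c,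
          Lp.coeFn_add (tensorLast h c) (tensorLast h' c), ae_splitLast_fst (Lp.coeFn_add h h')]
          with x h1 h2 h3 h4 h5
        rw [h4, Pi.add_apply, h1, h2, h3, h5, Pi.add_apply, add_mul])
      (by
        intro k h c
        ext1
        filter_upwards [coeFn_tensorLast (k • h) c, coeFn_tensorLast h c,
          Lp.coeFn_smul k (tensorLast h c), ae_splitLast_fst (Lp.coeFn_smul k h)]
          with x h1 h2 h3 h4
        rw [h3, Pi.smul_apply, h1, h2, h4, Pi.smul_apply, smul_eq_mul, smul_eq_mul, mul_assoc])
      (by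
        intro h c c'
        ext1
        filter_upwards [coeFn_tensorLast h (c + c'), coeFn_tensorLast h c, coeFn_tensorLast h c',
          Lp.coeFn_add (tensorLast h c) (tensorLast h c'), ae_splitLast_snd (Lp.coeFn_add c c')]
          with x h1 h2 h3 h4 h5
        rw [h4, Pi.add_apply, h1, h2, h3, h5, Pi.add_apply, mul_add])
      (by
        intro k h c
        ext1
        filter_upwards [coeFn_tensorLast h (k • c), coeFn_tensorLast h c,
          Lp.coeFn_smul k (tensorLast h c), ae_splitLast_snd (Lp.coeFn_smul k c)]
          with x h1 h2 h3 h4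
        rw [h3, Pi.smul_apply, h1, h2, h4, Pi.smul_apply, smul_eq_mul, smul_eq_mul]
        ring))
    1 (fun h c => by
      rw [one_mul]
      exact (norm_tensorLast h c).le)

theorem tensorLastL_apply (h : L2 R2) (c : L2 ℝ) : tensorLastL h c = tensorLast h c := rfl

theorem continuous_tensorLast : Continuous fun z : L2 R2 × L2 ℝ => tensorLast z.1 z.2 :=
  tensorLastL.continuous₂

theorem indicatorOp_tensorLast {S : Set R2} {T : Set ℝ} (hS : MeasurableSet S)
    (hT : MeasurableSet T) (h : L2 R2) (c : L2 ℝ) :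
    indicatorOp (splitLast ⁻¹' (S ×ˢ T)) (tensorLast h c) =
      tensorLast (indicatorOp S h) (indicatorOp T c) := by
  ext1
  filter_upwards [coeFn_indicatorOp (splitLast.measurable (hS.prod hT)) (tensorLast h c),
    coeFn_tensorLast h c, coeFn_tensorLast (indicatorOp S h) (indicatorOp T c),
    ae_splitLast_fst (coeFn_indicatorOp hS h), ae_splitLast_snd (coeFn_indicatorOp hT c)]
    with x h1 h2 h3 h4 h5
  rw [h1, h3, h4, h5]
  by_cases hx1 : (splitLast x).1 ∈ S <;> by_cases hx2 : (splitLast x).2 ∈ T <;>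
    simp [Set.indicator, hx1, hx2, h2]

theorem generateFrom_preimage_splitLast : (inferInstance : MeasurableSpace R3) =
    MeasurableSpace.generateFrom (Set.preimage splitLast ''
      Set.image2 (· ×ˢ ·) {s : Set R2 | MeasurableSet s} {t : Set ℝ | MeasurableSet t}) := by
  rw [← MeasurableSpace.comap_generateFrom, generateFrom_prod]
  exact splitLast.measurableEmbedding.comap_eq.symm

/-- Product vectors are total. -/
theorem eq_zero_of_inner_tensorLast {f : L2 R3} (hf : ∀ h c, inner ℂ (tensorLast h c) f = 0) :
    f = 0 := by
  -- A square integrable function need not be integrable, so the argument is localized to boxes of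
  -- finite measure. Testing on indicator functions shows that the complex measure with density `f`
  -- vanishes on rectangles, hence on every Borel subset of each box.
  set B : ℕ → Set R3 := fun n => splitLast ⁻¹' (Metric.ball 0 n ×ˢ Metric.ball 0 n) with hB
  have hBm : ∀ n, MeasurableSet (B n) := fun n =>
    splitLast.measurable (measurableSet_ball.prod measurableSet_ball)
  have hBfin : ∀ n, volume (B n) < ⊤ := by
    intro n
    rw [hB, measurePreserving_splitLast.measure_preimage_equiv, Measure.volume_eq_prod,
      Measure.prod_prod]
    exact ENNReal.mul_lt_top measure_ball_lt_top measure_ball_lt_top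
  have hrect : ∀ (S : Set R2) (T : Set ℝ), MeasurableSet S → MeasurableSet T → volume S < ⊤ →
      volume T < ⊤ → ∫ x in splitLast ⁻¹' (S ×ˢ T), f x = 0 := by
    intro S T hS hT hS' hT'
    have h := hf (indicatorConstLp 2 hS hS'.ne 1) (indicatorConstLp 2 hT hT'.ne 1)
    rw [← h, L2.inner_def, ← integral_indicator (splitLast.measurable (hS.prod hT))]
    refine integral_congr_ae ?_
    filter_upwards [coeFn_tensorLast (indicatorConstLp 2 hS hS'.ne 1)
      (indicatorConstLp 2 hT hT'.ne 1),
      ae_splitLast_fst (indicatorConstLp_coeFn (p := 2) (hs := hS) (hμs := hS'.ne) (c := (1 : ℂ))),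
      ae_splitLast_snd (indicatorConstLp_coeFn (p := 2) (hs := hT) (hμs := hT'.ne) (c := (1 : ℂ)))]
      with x h1 h2 h3
    rw [h1, h2, h3]
    by_cases hx1 : (splitLast x).1 ∈ S <;> by_cases hx2 : (splitLast x).2 ∈ T <;>
      simp [Set.indicator, hx1, hx2]
  have hint : ∀ n, Integrable f ((volume : Measure R3).restrict (B n)) := by
    intro n
    have : IsFiniteMeasure ((volume : Measure R3).restrict (B n)) :=
      ⟨by rw [Measure.restrict_apply_univ]; exact hBfin n⟩
    exact ((Lp.memLp f).restrict (B n)).integrable one_le_two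
  have hzero : ∀ n, f =ᵐ[(volume : Measure R3).restrict (B n)] 0 := by
    intro n
    refine Integrable.ae_eq_of_withDensityᵥ_eq (hint n) (integrable_zero _ _ _) ?_
    have hr : ∀ S T, MeasurableSet S → MeasurableSet T →
        ∫ x in splitLast ⁻¹' (S ×ˢ T), f x ∂((volume : Measure R3).restrict (B n)) = 0 := by
      intro S T hS hT
      rw [Measure.restrict_restrict (splitLast.measurable (hS.prod hT)), hB, ← Set.preimage_inter,
        Set.prod_inter_prod]
      exact hrect _ _ (hS.inter measurableSet_ball) (hT.inter measurableSet_ball)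
        ((measure_mono Set.inter_subset_right).trans_lt measure_ball_lt_top)
        ((measure_mono Set.inter_subset_right).trans_lt measure_ball_lt_top)
    rw [withDensityᵥ_zero]
    refine VectorMeasure.ext_of_generateFrom _ ?_ generateFrom_preimage_splitLast
      (isPiSystem_prod.comap splitLast) ?_
    · rintro _ ⟨_, ⟨S, hS, T, hT, rfl⟩, rfl⟩
      rw [withDensityᵥ_apply (hint n) (splitLast.measurable (MeasurableSet.prod hS hT)), hr S T hS hT]
      rfl
    · have h := hr Set.univ Set.univ MeasurableSet.univ MeasurableSet.univ
      rw [Set.univ_prod_univ, Set.preimage_univ] at h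
      rw [withDensityᵥ_apply (hint n) MeasurableSet.univ, h]
      rfl
  have hunion : ⋃ n, B n = Set.univ := by
    refine Set.eq_univ_of_forall fun x => ?_
    obtain ⟨n, hn⟩ := exists_nat_gt (max ‖(splitLast x).1‖ ‖(splitLast x).2‖)
    refine Set.mem_iUnion.2 ⟨n, ?_, ?_⟩
    · rw [mem_ball_zero_iff]
      exact (le_max_left _ _).trans_lt hn
    · rw [mem_ball_zero_iff]
      exact (le_max_right _ _).trans_lt hn
  have h := (ae_restrict_iUnion_iff B (fun x => f x = (0 : R3 → ℂ) x)).2 hzero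
  rw [hunion, Measure.restrict_univ] at h
  rw [Lp.eq_zero_iff_ae_eq_zero]
  exact h

/-! ### The partial Fourier transform -/

/-- The kernel `exp(-2πi⟪x, ξ⟫)` factorizes along the splitting, so Fubini gives the claim for
Schwartz factors; density and continuity do the rest. -/
theorem fourierTransform_tensorLast (h : L2 R2) (c : L2 ℝ) :
    Lp.fourierTransformₗᵢ R3 ℂ (tensorLast h c) =
      tensorLast (Lp.fourierTransformₗᵢ R2 ℂ h) (Lp.fourierTransformₗᵢ ℝ ℂ c) := by
  have hclosed : IsClosed {z : L2 R2 × L2 ℝ | Lp.fourierTransformₗᵢ R3 ℂ (tensorLast z.1 z.2) =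
      tensorLast (Lp.fourierTransformₗᵢ R2 ℂ z.1) (Lp.fourierTransformₗᵢ ℝ ℂ z.2)} :=
    isClosed_eq ((Lp.fourierTransformₗᵢ R3 ℂ).continuous.comp continuous_tensorLast)
      (continuous_tensorLast.comp (((Lp.fourierTransformₗᵢ R2 ℂ).continuous.comp
        continuous_fst).prodMk ((Lp.fourierTransformₗᵢ ℝ ℂ).continuous.comp continuous_snd)))
  refine (denseRange_schwartz_toLp.prodMap denseRange_schwartz_toLp).induction_on
    (p := fun z => Lp.fourierTransformₗᵢ R3 ℂ (tensorLast z.1 z.2) =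
      tensorLast (Lp.fourierTransformₗᵢ R2 ℂ z.1) (Lp.fourierTransformₗᵢ ℝ ℂ z.2)) (h, c) hclosed ?_
  rintro ⟨h, c⟩
  have hint : Integrable (fun x : R3 => h (splitLast x).1 * c (splitLast x).2) volume :=
    (measurePreserving_splitLast.integrable_comp_emb splitLast.measurableEmbedding
      (g := fun z : R2 × ℝ => h z.1 * c z.2)).2
      ((h.integrable (μ := volume)).mul_prod (c.integrable (μ := volume)))
  have htens : tensorLast (h.toLp 2 volume) (c.toLp 2 volume) =
    (memLp_mul_splitLast (h.memLp 2 volume) (c.memLp 2 volume)).toLp := tensorLast_toLp _ _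
  change Lp.fourierTransformₗᵢ R3 ℂ (tensorLast (h.toLp 2 volume) (c.toLp 2 volume)) =
    tensorLast (Lp.fourierTransformₗᵢ R2 ℂ (h.toLp 2 volume))
      (Lp.fourierTransformₗᵢ ℝ ℂ (c.toLp 2 volume))
  rw [htens]
  ext1
  filter_upwards [fourierTransform_toLp_ae_eq hint
    (memLp_mul_splitLast (h.memLp 2 volume) (c.memLp 2 volume)),
    coeFn_tensorLast (Lp.fourierTransformₗᵢ R2 ℂ (h.toLp 2 volume))
      (Lp.fourierTransformₗᵢ ℝ ℂ (c.toLp 2 volume)),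
    ae_splitLast_fst (fourierTransform_toLp_ae_eq (h.integrable (μ := volume)) (h.memLp 2 volume)),
    ae_splitLast_snd (fourierTransform_toLp_ae_eq (c.integrable (μ := volume)) (c.memLp 2 volume))]
    with ξ h1 h2 h3 h4
  have h3' : Lp.fourierTransformₗᵢ R2 ℂ (h.toLp 2 volume) (splitLast ξ).1 =
    𝓕 (h : R2 → ℂ) (splitLast ξ).1 := h3
  have h4' : Lp.fourierTransformₗᵢ ℝ ℂ (c.toLp 2 volume) (splitLast ξ).2 =
    𝓕 (c : ℝ → ℂ) (splitLast ξ).2 := h4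
  rw [h1, h2, h3', h4', Real.fourier_eq', Real.fourier_eq', Real.fourier_eq',
    ← integral_prod_mul, ← Measure.volume_eq_prod, ← measurePreserving_splitLast.integral_comp']
  congr 1
  funext x
  have hin : inner ℝ x ξ = inner ℝ (splitLast x).1 (splitLast ξ).1 +
      inner ℝ (splitLast x).2 (splitLast ξ).2 := by
    simp [splitLast_apply, PiLp.inner_apply, Fin.sum_univ_succ]
    ring
  rw [hin]
  simp only [smul_eq_mul, mul_add, Complex.ofReal_add, add_mul, Complex.exp_add]
  ring

/-- The product of two Hilbert bases. -/
def tensorLastBasis {ι ι' : Type} (b : HilbertBasis ι ℂ (L2 R2)) (d : HilbertBasis ι' ℂ (L2 ℝ)) :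
    HilbertBasis (ι × ι') ℂ (L2 R3) :=
  HilbertBasis.mkOfOrthogonalEqBot (v := fun i : ι × ι' => tensorLast (b i.1) (d i.2))
    (by
      classical
      rw [orthonormal_iff_ite]
      rintro ⟨i, i'⟩ ⟨j, j'⟩
      rw [inner_tensorLast, orthonormal_iff_ite.1 b.orthonormal, orthonormal_iff_ite.1 d.orthonormal]
      by_cases h1 : i = j <;> by_cases h2 : i' = j' <;> simp [h1, h2])
    (by
      rw [Submodule.eq_bot_iff]
      intro f hf
      rw [Submodule.mem_orthogonal] at hf
      refine eq_zero_of_inner_tensorLast fun h c => ?_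
      -- Orthogonality to basis products extends to all products one factor at a time, by expanding
      -- first `c` and then `h`.
      have h1 : ∀ i c, inner ℂ (tensorLast (b i) c) f = 0 := by
        intro i c
        have h2 := ((d.hasSum_repr c).mapL (tensorLastL (b i))).mapL (innerSL ℂ f)
        have h3 : ∀ j, (innerSL ℂ f) (tensorLastL (b i) (d.repr c j • d j)) = 0 := by
          intro j
          rw [map_smul, map_smul, innerSL_apply_apply, tensorLastL_apply,
            inner_eq_zero_symm.1 (hf _ (Submodule.subset_span ⟨(i, j), rfl⟩)), smul_zero]
        simp only [h3] at h2
        exact inner_eq_zero_symm.1 (h2.unique hasSum_zero)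
      have h2 := ((b.hasSum_repr h).mapL (tensorLastL.flip c)).mapL (innerSL ℂ f)
      have h3 : ∀ i, (innerSL ℂ f) (tensorLastL.flip c (b.repr h i • b i)) = 0 := by
        intro i
        rw [map_smul, map_smul, innerSL_apply_apply, ContinuousLinearMap.flip_apply,
          tensorLastL_apply, inner_eq_zero_symm.1 (h1 i c), smul_zero]
      simp only [h3] at h2
      exact inner_eq_zero_symm.1 (h2.unique hasSum_zero))

theorem tensorLastBasis_apply {ι ι' : Type} (b : HilbertBasis ι ℂ (L2 R2))
    (d : HilbertBasis ι' ℂ (L2 ℝ)) (i : ι × ι') :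
    tensorLastBasis b d i = tensorLast (b i.1) (d i.2) :=
  congrFun (HilbertBasis.coe_mkOfOrthogonalEqBot _ _) i

/-- Bounded operators that agree on product vectors are equal. -/
theorem ext_tensorLast {A B : L2 R3 →L[ℂ] L2 R3}
    (h : ∀ a c, A (tensorLast a c) = B (tensorLast a c)) : A = B := by
  obtain ⟨_, b, -⟩ := exists_hilbertBasis ℂ (L2 R2)
  obtain ⟨_, d, -⟩ := exists_hilbertBasis ℂ (L2 ℝ)
  refine ContinuousLinearMap.ext_on (Submodule.dense_iff_topologicalClosure_eq_top.2
    (tensorLastBasis b d).dense_span) ?_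
  rintro _ ⟨i, rfl⟩
  rw [tensorLastBasis_apply, h]

/-- The Fourier transform in the coordinate `q₂`. -/
theorem exists_partialFourier : ∃ F : L2 R3 ≃ₗᵢ[ℂ] L2 R3, ∀ a c,
    F (tensorLast a c) = tensorLast a (Lp.fourierTransformₗᵢ ℝ ℂ c) := by
  classical
  obtain ⟨_, b, -⟩ := exists_hilbertBasis ℂ (L2 R2)
  obtain ⟨_, d, -⟩ := exists_hilbertBasis ℂ (L2 ℝ)
  -- `d'` is the Fourier image of the basis `d`. The desired operator is the unitary matching the
  -- product basis of `b` and `d` with that of `b` and `d'`.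
  set d' := HilbertBasis.ofRepr ((Lp.fourierTransformₗᵢ ℝ ℂ).symm.trans d.repr) with hd'
  have hd'_apply : ∀ j, d' j = Lp.fourierTransformₗᵢ ℝ ℂ (d j) := fun j => by
    rw [← HilbertBasis.repr_symm_single, ← HilbertBasis.repr_symm_single, hd']
    rfl
  set F := (tensorLastBasis b d).repr.trans (tensorLastBasis b d').repr.symm with hF
  have hFb : ∀ i j, F (tensorLast (b i) (d j)) =
      tensorLast (b i) (Lp.fourierTransformₗᵢ ℝ ℂ (d j)) := by
    intro i j
    rw [← tensorLastBasis_apply b d (i, j), hF, LinearIsometryEquiv.trans_apply,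
      HilbertBasis.repr_self, HilbertBasis.repr_symm_single, tensorLastBasis_apply, hd'_apply]
  refine ⟨F, fun a c => ?_⟩
  have h1 : ∀ i, (F.toContinuousLinearEquiv : L2 R3 →L[ℂ] L2 R3) ∘L tensorLastL (b i) =
      tensorLastL (b i) ∘L
        ((Lp.fourierTransformₗᵢ ℝ ℂ).toContinuousLinearEquiv : L2 ℝ →L[ℂ] L2 ℝ) := by
    intro i
    refine ContinuousLinearMap.ext_on (Submodule.dense_iff_topologicalClosure_eq_top.2
      d.dense_span) ?_
    rintro _ ⟨j, rfl⟩
    exact hFb i j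
  have h2 : (F.toContinuousLinearEquiv : L2 R3 →L[ℂ] L2 R3) ∘L tensorLastL.flip c =
      tensorLastL.flip (Lp.fourierTransformₗᵢ ℝ ℂ c) := by
    refine ContinuousLinearMap.ext_on (Submodule.dense_iff_topologicalClosure_eq_top.2
      b.dense_span) ?_
    rintro _ ⟨i, rfl⟩
    exact congrArg (fun A : L2 ℝ →L[ℂ] L2 R3 => A c) (h1 i)
  exact congrArg (fun A : L2 R2 →L[ℂ] L2 R3 => A a) h2

/-- There is a unitary operator that turns the two pointer observables into multiplication
operators by coordinates. -/
theorem exists_diagonalize_pointer : ∃ F : L2 R3 ≃ₗᵢ[ℂ] L2 R3, ∀ X Y : Set ℝ, MeasurableSet X →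
    MeasurableSet Y → ∀ f : L2 R3,
      F (pointer X Y f) = indicatorOp {x : R3 | x 1 ∈ X ∧ 2 * Real.pi * x 2 ∈ Y} (F f) := by
  obtain ⟨F, hF⟩ := exists_partialFourier
  refine ⟨F, fun X Y hX hY f => ?_⟩
  set S : Set R2 := {y | y 1 ∈ X} with hS
  set T : Set ℝ := {c | 2 * Real.pi * c ∈ Y} with hT
  have hSm : MeasurableSet S := by
    have : Measurable fun y : R2 => y 1 := by fun_prop
    exact this hX
  have hTm : MeasurableSet T := by
    have : Measurable fun c : ℝ => 2 * Real.pi * c := by fun_prop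
    exact this hY
  have e1 : {x : R3 | inner ℝ (dir 1) x ∈ X} = splitLast ⁻¹' (S ×ˢ Set.univ) := by
    ext x
    simp [hS, splitLast_apply, dir, EuclideanSpace.inner_single_left]
  have e2 : {x : R3 | 2 * Real.pi * inner ℝ (dir 2) x ∈ Y} = splitLast ⁻¹' (Set.univ ×ˢ T) := by
    ext x
    simp [hT, splitLast_apply, dir, EuclideanSpace.inner_single_left]
  have e3 : {x : R3 | x 1 ∈ X ∧ 2 * Real.pi * x 2 ∈ Y} = splitLast ⁻¹' (S ×ˢ T) := by
    ext x
    simp [hT, hS, splitLast_apply]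
  have huniv : ∀ {E : Type} [NormedAddCommGroup E] [InnerProductSpace ℝ E] [MeasurableSpace E]
      [BorelSpace E] [FiniteDimensional ℝ E] (g : L2 E), indicatorOp Set.univ g = g := by
    intro E _ _ _ _ _ g
    ext1
    filter_upwards [coeFn_indicatorOp MeasurableSet.univ g] with x hx
    rw [hx, Set.indicator_univ]
  have key : (F.toContinuousLinearEquiv : L2 R3 →L[ℂ] L2 R3) ∘L pointer X Y =
      indicatorOp (splitLast ⁻¹' (S ×ˢ T)) ∘L
        (F.toContinuousLinearEquiv : L2 R3 →L[ℂ] L2 R3) := by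
    refine ext_tensorLast fun a c => ?_
    -- The full Fourier transform in the definition of `momentumPVM` also acts on `(q, q₁)`, but
    -- there it cancels against its inverse, leaving only the transform in `q₂`.
    have hmom : momentumPVM (dir 2) Y (tensorLast a c) = tensorLast a
        ((Lp.fourierTransformₗᵢ ℝ ℂ).symm (indicatorOp T (Lp.fourierTransformₗᵢ ℝ ℂ c))) := by
      change (Lp.fourierTransformₗᵢ R3 ℂ).symm
        (indicatorOp _ (Lp.fourierTransformₗᵢ R3 ℂ (tensorLast a c))) = _
      rw [e2, LinearIsometryEquiv.symm_apply_eq, fourierTransform_tensorLast,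
        fourierTransform_tensorLast, indicatorOp_tensorLast MeasurableSet.univ hTm, huniv,
        LinearIsometryEquiv.apply_symm_apply]
    change F (positionPVM (dir 1) X (momentumPVM (dir 2) Y (tensorLast a c))) =
      indicatorOp (splitLast ⁻¹' (S ×ˢ T)) (F (tensorLast a c))
    rw [hmom, positionPVM, e1, indicatorOp_tensorLast hSm MeasurableSet.univ, huniv, hF, hF,
      LinearIsometryEquiv.apply_symm_apply, indicatorOp_tensorLast hSm hTm]
  rw [e3]
  exact congrArg (fun A : L2 R3 →L[ℂ] L2 R3 => A f) key

/-! ### Traces -/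

section Trace

variable {H K : Type} [NormedAddCommGroup H] [InnerProductSpace ℂ H]

theorem hasSum_norm_inner_sq {ι : Type} (e : HilbertBasis ι ℂ H) (v : H) :
    HasSum (fun i => ‖inner ℂ (e i) v‖ ^ 2) (‖v‖ ^ 2) := by
  have h := e.hasSum_inner_mul_inner v v
  rw [inner_self_eq_norm_sq_to_K] at h
  have h1 : ∀ i, inner ℂ v (e i) * inner ℂ (e i) v = ((‖inner ℂ (e i) v‖ ^ 2 : ℝ) : ℂ) := by
    intro i
    rw [← inner_conj_symm, RCLike.conj_mul]
    norm_cast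
  simp only [h1] at h
  rw [← Complex.hasSum_ofReal]
  simpa using h

theorem summable_norm_inner_sq {ι κ : Type} (e : HilbertBasis ι ℂ H) {v : κ → H}
    (hv : Summable fun k => ‖v k‖ ^ 2) :
    Summable fun z : κ × ι => ‖inner ℂ (e z.2) (v z.1)‖ ^ 2 := by
  rw [summable_prod_of_nonneg (fun _ => by positivity)]
  refine ⟨fun k => (hasSum_norm_inner_sq e (v k)).summable, ?_⟩
  simpa only [(hasSum_norm_inner_sq e _).tsum_eq] using hv

variable [CompleteSpace H] [NormedAddCommGroup K] [InnerProductSpace ℂ K] [CompleteSpace K]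

theorem HasTrace.unique {T : H →L[ℂ] H} {c c' : ℂ} (h : HasTrace T c) (h' : HasTrace T c') :
    c = c' := by
  obtain ⟨_, b, -⟩ := exists_hilbertBasis ℂ H
  exact (h _ b).unique (h' _ b)

/-- The trace of `A A* M` for a Hilbert–Schmidt operator `A` and a bounded operator `M`. -/
theorem hasTrace_comp_adjoint (A : K →L[ℂ] H) (M : H →L[ℂ] H) {κ : Type}
    (b : HilbertBasis κ ℂ K) (hA : Summable fun k => ‖A (b k)‖ ^ 2) :
    HasTrace (A ∘L ContinuousLinearMap.adjoint A ∘L M)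
      (∑' k, inner ℂ (A (b k)) (M (A (b k)))) := by
  intro ι e
  set M' := ContinuousLinearMap.adjoint M with hM'
  -- Summing this family over `ι` first gives the claimed value, and over `κ` first gives the
  -- diagonal elements of `A A* M`. Absolute summability over pairs permits the exchange.
  set f : κ × ι → ℂ := fun z =>
    inner ℂ (M' (A (b z.1))) (e z.2) * inner ℂ (e z.2) (A (b z.1)) with hf
  have hA' : Summable fun k => ‖M' (A (b k))‖ ^ 2 := by
    refine (hA.mul_left (‖M'‖ ^ 2)).of_nonneg_of_le (fun _ => by positivity) fun k => ?_
    rw [← mul_pow]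
    exact pow_le_pow_left₀ (norm_nonneg _) (M'.le_opNorm _) 2
  have hsum : Summable f := by
    refine Summable.of_norm_bounded ((summable_norm_inner_sq e hA').add
      (summable_norm_inner_sq e hA)) fun z => ?_
    rw [hf, norm_mul, norm_inner_symm]
    nlinarith [sq_nonneg (‖inner ℂ (e z.2) (M' (A (b z.1)))‖ - ‖inner ℂ (e z.2) (A (b z.1))‖),
      sq_nonneg (‖inner ℂ (e z.2) (M' (A (b z.1)))‖), sq_nonneg (‖inner ℂ (e z.2) (A (b z.1))‖)]
  have h1 : ∀ k, HasSum (fun i => f (k, i)) (inner ℂ (A (b k)) (M (A (b k)))) := by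
    intro k
    have h := e.hasSum_inner_mul_inner (M' (A (b k))) (A (b k))
    rwa [hM', ContinuousLinearMap.adjoint_inner_left] at h
  have h2 : ∀ i, HasSum (fun k => f (k, i))
      (inner ℂ (e i) ((A ∘L ContinuousLinearMap.adjoint A ∘L M) (e i))) := by
    intro i
    have h := b.hasSum_inner_mul_inner (ContinuousLinearMap.adjoint A (e i))
      (ContinuousLinearMap.adjoint A (M (e i)))
    rw [ContinuousLinearMap.adjoint_inner_left] at h
    refine h.congr_fun fun k => ?_
    simp only [hf, hM']
    rw [ContinuousLinearMap.adjoint_inner_left, ContinuousLinearMap.adjoint_inner_right,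
      ContinuousLinearMap.adjoint_inner_left, mul_comm]
  have h3 := hsum.hasSum.prod_fiberwise h1
  rw [h3.tsum_eq]
  exact ((Equiv.prodComm ι κ).hasSum_iff.2 hsum.hasSum).prod_fiberwise h2

end Trace

/-! ### Positive operator valued measures -/

namespace POVM

variable {Ω : Type} [MeasurableSpace Ω] {H K : Type} [NormedAddCommGroup H]
  [InnerProductSpace ℂ H] [CompleteSpace H] [NormedAddCommGroup K] [InnerProductSpace ℂ K]
  [CompleteSpace K]

theorem effect_empty (G : POVM Ω H) : G.effect ∅ = 0 := by
  ext1 ψ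
  refine ext_inner_left ℂ fun φ => ?_
  -- Countable additivity is applied to a sequence of empty sets: a summable constant sequence must
  -- be zero.
  have h := G.hasSum_iUnion (fun _ => ∅) (fun _ => MeasurableSet.empty)
    (fun _ _ _ => disjoint_bot_left) φ ψ
  rw [(summable_const_iff _).1 h.summable]
  simp

/-- The complex measure of a pair of vectors. -/
def toVectorMeasure (G : POVM Ω H) (φ ψ : H) : VectorMeasure Ω ℂ where
  measureOf' Z := inner ℂ φ (G.effect Z ψ)
  empty' := by simp [effect_empty]
  not_measurable' Z hZ := by simp [G.effect_of_not_measurable Z hZ]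
  m_iUnion' Z hZ hd := G.hasSum_iUnion Z hZ hd φ ψ

theorem toVectorMeasure_apply (G : POVM Ω H) (φ ψ : H) (Z : Set Ω) :
    G.toVectorMeasure φ ψ Z = inner ℂ φ (G.effect Z ψ) := rfl

theorem ext_effect {G G' : POVM Ω H} (h : ∀ Z, MeasurableSet Z → G.effect Z = G'.effect Z) :
    G = G' := by
  have he : G.effect = G'.effect := by
    funext Z
    by_cases hZ : MeasurableSet Z
    · exact h Z hZ
    · rw [G.effect_of_not_measurable Z hZ, G'.effect_of_not_measurable Z hZ]
  cases G
  cases G'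
  congr

/-- The terms are bounded in norm by `‖A k‖ ^ 2`, so the series converges in operator norm and its
`tsum` carries no default value. -/
theorem summable_conj (P : POVM Ω K) (hP : ∀ Z, ‖P.effect Z‖ ≤ 1) {κ : Type}
    {A : κ → H →L[ℂ] K} (hA : Summable fun k => ‖A k‖ ^ 2) (Z : Set Ω) :
    Summable fun k => ContinuousLinearMap.adjoint (A k) ∘L P.effect Z ∘L A k := by
  refine Summable.of_norm_bounded hA fun k => ?_
  refine (ContinuousLinearMap.opNorm_comp_le _ _).trans ?_
  rw [LinearIsometryEquiv.norm_map, sq]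
  gcongr
  refine (ContinuousLinearMap.opNorm_comp_le _ _).trans ?_
  exact mul_le_of_le_one_left (norm_nonneg _) (hP Z)

theorem hasSum_inner_conj (P : POVM Ω K) (hP : ∀ Z, ‖P.effect Z‖ ≤ 1) {κ : Type}
    {A : κ → H →L[ℂ] K} (hA : Summable fun k => ‖A k‖ ^ 2) (Z : Set Ω) (φ ψ : H) :
    HasSum (fun k => inner ℂ (A k φ) (P.effect Z (A k ψ)))
      (inner ℂ φ ((∑' k, ContinuousLinearMap.adjoint (A k) ∘L P.effect Z ∘L A k) ψ)) := by
  have h := ((P.summable_conj hP hA Z).hasSum.mapL (ContinuousLinearMap.apply ℂ H ψ)).mapL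
    (innerSL ℂ φ)
  simpa [ContinuousLinearMap.adjoint_inner_right] using h

/-- The observable `Z ↦ ∑ Aₖ* P(Z) Aₖ` for a contractive observable `P` and operators with
`∑ Aₖ* Aₖ = 1`. -/
def compress (P : POVM Ω K) (hP : ∀ Z, ‖P.effect Z‖ ≤ 1) {κ : Type} (A : κ → H →L[ℂ] K)
    (hA : Summable fun k => ‖A k‖ ^ 2)
    (h1 : ∀ φ ψ, HasSum (fun k => inner ℂ (A k φ) (A k ψ)) (inner ℂ φ ψ)) : POVM Ω H :=
  have hinner := P.hasSum_inner_conj hP hA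
  { effect := fun Z => ∑' k, ContinuousLinearMap.adjoint (A k) ∘L P.effect Z ∘L A k
    effect_of_not_measurable := fun Z hZ => by simp [P.effect_of_not_measurable Z hZ]
    isPositive := fun Z hZ => by
      rw [← ContinuousLinearMap.nonneg_iff_isPositive]
      refine tsum_nonneg fun k => ?_
      rw [ContinuousLinearMap.nonneg_iff_isPositive]
      exact (P.isPositive Z hZ).adjoint_conj (A k)
    effect_univ := by
      ext1 ψ
      refine ext_inner_left ℂ fun φ => ?_
      have h := hinner Set.univ φ ψ
      simp only [P.effect_univ, one_apply_eq_self] at h ⊢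
      exact h.unique (h1 φ ψ)
    hasSum_iUnion := fun Z hZ hd φ ψ => by
      have hb : Summable fun k => ‖A k‖ ^ 2 * (‖φ‖ * ‖ψ‖) := hA.mul_right _
      have hlim : ∀ k, Tendsto (fun s : Finset ℕ => ∑ n ∈ s,
          inner ℂ (A k φ) (P.effect (Z n) (A k ψ))) atTop
          (𝓝 (inner ℂ (A k φ) (P.effect (⋃ n, Z n) (A k ψ)))) := fun k =>
        P.hasSum_iUnion Z hZ hd _ _
      -- By additivity a finite partial sum belongs to the effect of a finite union, again of norm
      -- at most one. The bound is therefore uniform in `s`, and dominated convergence exchanges the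
      -- limit over `s` with the sum over `k`.
      have hbound : ∀ (s : Finset ℕ) k, ‖∑ n ∈ s, inner ℂ (A k φ) (P.effect (Z n) (A k ψ))‖ ≤
          ‖A k‖ ^ 2 * (‖φ‖ * ‖ψ‖) := by
        intro s k
        have h := (P.toVectorMeasure (A k φ) (A k ψ)).of_biUnion_finset (s := s) (f := Z)
          (fun i _ j _ hij => hd hij) (fun i _ => hZ i)
        simp only [toVectorMeasure_apply] at h
        rw [← h]
        refine (norm_inner_le_norm _ _).trans ?_
        have h2 : ‖P.effect (⋃ n ∈ s, Z n) (A k ψ)‖ ≤ ‖A k‖ * ‖ψ‖ := by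
          refine ((P.effect _).le_opNorm _).trans ?_
          refine (mul_le_of_le_one_left (norm_nonneg _) (hP _)).trans ((A k).le_opNorm ψ)
        calc _ ≤ (‖A k‖ * ‖φ‖) * (‖A k‖ * ‖ψ‖) := by
              gcongr
              exact (A k).le_opNorm φ
          _ = _ := by ring
      have h := tendsto_tsum_of_dominated_convergence hb hlim
        (Eventually.of_forall fun s k => hbound s k)
      rw [(hinner _ φ ψ).tsum_eq] at h
      refine h.congr fun s => ?_
      rw [Summable.tsum_finsetSum fun n _ => (hinner (Z n) φ ψ).summable]
      exact Finset.sum_congr rfl fun n _ => (hinner (Z n) φ ψ).tsum_eq }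

theorem hasSum_inner_compress (P : POVM Ω K) (hP : ∀ Z, ‖P.effect Z‖ ≤ 1) {κ : Type}
    (A : κ → H →L[ℂ] K) (hA : Summable fun k => ‖A k‖ ^ 2)
    (h1 : ∀ φ ψ, HasSum (fun k => inner ℂ (A k φ) (A k ψ)) (inner ℂ φ ψ)) (Z : Set Ω) (φ ψ : H) :
    HasSum (fun k => inner ℂ (A k φ) (P.effect Z (A k ψ)))
      (inner ℂ φ ((P.compress hP A hA h1).effect Z ψ)) :=
  P.hasSum_inner_conj hP hA Z φ ψ

end POVM

/-! ### Spectral measures given by multiplication with indicator functions -/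

section Indicator

variable {E : Type} [NormedAddCommGroup E] [InnerProductSpace ℝ E] [MeasurableSpace E]
  [BorelSpace E] [FiniteDimensional ℝ E]

theorem inner_indicatorOp {s : Set E} (hs : MeasurableSet s) (f g : L2 E) :
    inner ℂ f (indicatorOp s g) = ∫ x in s, inner ℂ (f x) (g x) := by
  rw [L2.inner_def, ← integral_indicator hs]
  refine integral_congr_ae ?_
  filter_upwards [coeFn_indicatorOp hs g] with x hx
  rw [hx]
  by_cases h : x ∈ s <;> simp [h]

theorem norm_indicatorOp_le (s : Set E) : ‖(indicatorOp s : L2 E →L[ℂ] L2 E)‖ ≤ 1 := by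
  by_cases hs : MeasurableSet s
  · rw [indicatorOp, dif_pos hs]
    exact LinearMap.mkContinuous_norm_le _ zero_le_one _
  · rw [indicatorOp, dif_neg hs, norm_zero]
    exact zero_le_one

/-- Multiplication by an indicator is an orthogonal projection, so it equals its adjoint composed
with itself. -/
theorem isPositive_indicatorOp {s : Set E} (hs : MeasurableSet s) :
    (indicatorOp s : L2 E →L[ℂ] L2 E).IsPositive := by
  have h : (indicatorOp s : L2 E →L[ℂ] L2 E) =
      ContinuousLinearMap.adjoint (indicatorOp s) ∘L indicatorOp s := by
    ext1 g
    refine ext_inner_left ℂ fun f => ?_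
    rw [ContinuousLinearMap.comp_apply, ContinuousLinearMap.adjoint_inner_right,
      inner_indicatorOp hs, inner_indicatorOp hs]
    refine setIntegral_congr_ae hs ?_
    filter_upwards [coeFn_indicatorOp hs f] with x hx hxs
    rw [hx, Set.indicator_of_mem hxs]
  rw [h]
  exact ContinuousLinearMap.isPositive_adjoint_comp_self _

/-- The observable of a measurable function of position. -/
def indicatorPOVM {Ω : Type} [MeasurableSpace Ω] (g : E → Ω) (hg : Measurable g) :
    POVM Ω (L2 E) where
  -- Measurability is tested on `Z` itself, because the preimage of a non-measurable set may be
  -- measurable.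
  effect Z := open Classical in if MeasurableSet Z then indicatorOp (g ⁻¹' Z) else 0
  effect_of_not_measurable Z hZ := if_neg hZ
  isPositive Z hZ := by
    rw [if_pos hZ]
    exact isPositive_indicatorOp (hg hZ)
  effect_univ := by
    rw [if_pos MeasurableSet.univ, Set.preimage_univ]
    ext1 f
    ext1
    filter_upwards [coeFn_indicatorOp MeasurableSet.univ f] with x hx
    rw [hx, Set.indicator_univ]
    rfl
  hasSum_iUnion Z hZ hd φ ψ := by
    simp only [if_pos (hZ _), if_pos (MeasurableSet.iUnion hZ), Set.preimage_iUnion]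
    rw [inner_indicatorOp (MeasurableSet.iUnion fun n => hg (hZ n))]
    simp only [inner_indicatorOp (hg (hZ _))]
    exact hasSum_integral_iUnion (fun n => hg (hZ n)) (fun i j hij => (hd hij).preimage g)
      (L2.integrable_inner φ ψ).integrableOn

theorem indicatorPOVM_effect {Ω : Type} [MeasurableSpace Ω] (g : E → Ω) (hg : Measurable g)
    {Z : Set Ω} (hZ : MeasurableSet Z) : (indicatorPOVM g hg).effect Z = indicatorOp (g ⁻¹' Z) :=
  if_pos hZ

theorem norm_indicatorPOVM_le {Ω : Type} [MeasurableSpace Ω] (g : E → Ω) (hg : Measurable g)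
    (Z : Set Ω) : ‖(indicatorPOVM g hg).effect Z‖ ≤ 1 := by
  by_cases hZ : MeasurableSet Z
  · rw [indicatorPOVM_effect g hg hZ]
    exact norm_indicatorOp_le _
  · rw [(indicatorPOVM g hg).effect_of_not_measurable Z hZ, norm_zero]
    exact zero_le_one

end Indicator

/-! ### The effective observable -/

theorem coeFn_tensor (ψ : L2 ℝ) (φ : L2 R2) :
    tensor ψ φ =ᵐ[volume] fun x => ψ (split x).1 * φ (split x).2 :=
  (memLp_tensor ψ φ).coeFn_toLp

theorem ae_split_fst {p : ℝ → Prop} (h : ∀ᵐ y, p y) : ∀ᵐ x : R3, p (split x).1 :=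
  (Measure.quasiMeasurePreserving_fst.comp measurePreserving_split.quasiMeasurePreserving).ae h

/-- The bounded operator `ψ ↦ ψ ⊗ φ`. -/
def tensorR (φ : L2 R2) : L2 ℝ →L[ℂ] L2 R3 :=
  LinearMap.mkContinuous
    { toFun := fun ψ => tensor ψ φ
      map_add' := by
        intro ψ ψ'
        ext1
        filter_upwards [coeFn_tensor (ψ + ψ') φ, coeFn_tensor ψ φ, coeFn_tensor ψ' φ,
          Lp.coeFn_add (tensor ψ φ) (tensor ψ' φ), ae_split_fst (Lp.coeFn_add ψ ψ')]
          with x h1 h2 h3 h4 h5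
        rw [h4, Pi.add_apply, h1, h2, h3, h5, Pi.add_apply, add_mul]
      map_smul' := by
        intro c ψ
        ext1
        filter_upwards [coeFn_tensor (c • ψ) φ, coeFn_tensor ψ φ, Lp.coeFn_smul c (tensor ψ φ),
          ae_split_fst (Lp.coeFn_smul c ψ)] with x h1 h2 h3 h4
        rw [RingHom.id_apply, h3, Pi.smul_apply, h1, h2, h4, Pi.smul_apply, smul_eq_mul,
          smul_eq_mul, mul_assoc] }
    ‖φ‖ (fun ψ => (norm_tensor ψ φ).le.trans_eq (mul_comm _ _))

theorem inner_coupling (lam mu κ : ℝ) (f g : L2 R3) :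
    inner ℂ (coupling lam mu κ f) (coupling lam mu κ g) = inner ℂ f g := by
  rw [coupling_apply, coupling_apply, LinearIsometry.inner_map_map]

theorem norm_coupling (lam mu κ : ℝ) (f : L2 R3) : ‖coupling lam mu κ f‖ = ‖f‖ := by
  rw [coupling_apply, LinearIsometry.norm_map]

theorem image_mul_left_eq_preimage {a : ℝ} (ha : a ≠ 0) (X : Set ℝ) :
    (fun x => a * x) '' X = (fun x => x / a) ⁻¹' X := by
  ext y
  constructor
  · rintro ⟨x, hx, rfl⟩
    simpa [ha] using hx
  · intro hy
    exact ⟨y / a, hy, by field_simp⟩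

/-- A density operator is the square of a self-adjoint Hilbert–Schmidt operator of norm one. -/
theorem IsDensityOperator.exists_sqrt {H : Type} [NormedAddCommGroup H] [InnerProductSpace ℂ H]
    [CompleteSpace H] {σ : H →L[ℂ] H} (hσ : IsDensityOperator σ) :
    ∃ S : H →L[ℂ] H, ContinuousLinearMap.adjoint S = S ∧ S ∘L S = σ ∧
      ∀ (ι : Type) (b : HilbertBasis ι ℂ H), HasSum (fun i => ‖S (b i)‖ ^ 2) 1 := by
  have h0 : 0 ≤ σ := (ContinuousLinearMap.nonneg_iff_isPositive σ).2 hσ.1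
  have hS := (ContinuousLinearMap.nonneg_iff_isPositive _).1 (CFC.sqrt_nonneg σ)
  have hadj : ContinuousLinearMap.adjoint (CFC.sqrt σ) = CFC.sqrt σ :=
    hS.isSelfAdjoint.adjoint_eq
  have hmul : CFC.sqrt σ ∘L CFC.sqrt σ = σ := CFC.sqrt_mul_sqrt_self σ h0
  refine ⟨CFC.sqrt σ, hadj, hmul, fun ι b => ?_⟩
  have h := hσ.2 ι b
  have h1 : ∀ i, inner ℂ (b i) (σ (b i)) = ((‖CFC.sqrt σ (b i)‖ ^ 2 : ℝ) : ℂ) := by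
    intro i
    conv_lhs => rw [← hmul]
    rw [ContinuousLinearMap.comp_apply, ← ContinuousLinearMap.adjoint_inner_left, hadj,
      inner_self_eq_norm_sq_to_K]
    norm_cast
  simp only [h1] at h
  rw [← Complex.hasSum_ofReal]
  simpa using h

section Effective

variable {lam mu κ : ℝ} {σ S : L2 R2 →L[ℂ] L2 R2} {ι : Type} (b : HilbertBasis ι ℂ (L2 R2))

/-- The outcome probabilities in terms of a square root of the probe state. -/
theorem hasTrace_coupling (hadj : ContinuousLinearMap.adjoint S = S) (hS : S ∘L S = σ)
    (hb : HasSum (fun i => ‖S (b i)‖ ^ 2) 1) (ψ : L2 ℝ) (M : L2 R3 →L[ℂ] L2 R3) :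
    HasTrace (coupling lam mu κ ∘L pureTensor ψ σ ∘L
        ContinuousLinearMap.adjoint (coupling lam mu κ) ∘L M)
      (∑' i, inner ℂ (coupling lam mu κ (tensor ψ (S (b i))))
        (M (coupling lam mu κ (tensor ψ (S (b i)))))) := by
  -- With `A = U (ψ ⊗ ·) S`, the evolved state is `A A*`, because `S` is self-adjoint with square
  -- `σ`.
  have h := hasTrace_comp_adjoint (coupling lam mu κ ∘L tensorL ψ ∘L S) M b ?_
  · have heq : coupling lam mu κ ∘L pureTensor ψ σ ∘L
        ContinuousLinearMap.adjoint (coupling lam mu κ) ∘L M =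
        (coupling lam mu κ ∘L tensorL ψ ∘L S) ∘L
          ContinuousLinearMap.adjoint (coupling lam mu κ ∘L tensorL ψ ∘L S) ∘L M := by
      rw [ContinuousLinearMap.adjoint_comp, ContinuousLinearMap.adjoint_comp, hadj, pureTensor, ← hS]
      rfl
    rw [heq]
    exact h
  · have h1 : ∀ i, ‖(coupling lam mu κ ∘L tensorL ψ ∘L S) (b i)‖ ^ 2 =
        ‖ψ‖ ^ 2 * ‖S (b i)‖ ^ 2 := by
      intro i
      change ‖coupling lam mu κ (tensor ψ (S (b i)))‖ ^ 2 = _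
      rw [norm_coupling, norm_tensor, mul_pow]
    simp only [h1]
    exact hb.summable.mul_left _

theorem IsEffectiveObservable.inner_effect (hadj : ContinuousLinearMap.adjoint S = S)
    (hS : S ∘L S = σ) (hb : HasSum (fun i => ‖S (b i)‖ ^ 2) 1) {G : POVM (ℝ × ℝ) (L2 ℝ)}
    (hG : IsEffectiveObservable lam mu κ σ G) {X Y : Set ℝ} (hX : MeasurableSet X)
    (hY : MeasurableSet Y) {ψ : L2 ℝ} (hψ : ‖ψ‖ = 1) :
    inner ℂ ψ (G.effect (X ×ˢ Y) ψ) = ∑' i, inner ℂ (coupling lam mu κ (tensor ψ (S (b i))))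
      (pointer ((fun x => lam * x) '' X) ((fun y => mu * y) '' Y)
        (coupling lam mu κ (tensor ψ (S (b i))))) :=
  (hG X Y hX hY ψ hψ).unique (hasTrace_coupling b hadj hS hb ψ _)

/-- The sharp joint observable of the diagonalized pointers, with the rescaling by `lam` and `mu`
built into the function `g`, is compressed by the operators `ψ ↦ F U(ψ ⊗ S bᵢ)`. -/
theorem exists_isEffectiveObservable (hlam : lam ≠ 0) (hmu : mu ≠ 0)
    (hadj : ContinuousLinearMap.adjoint S = S)
    (hS : S ∘L S = σ) (hb : HasSum (fun i => ‖S (b i)‖ ^ 2) 1) :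
    ∃ G, IsEffectiveObservable lam mu κ σ G := by
  obtain ⟨F, hF⟩ := exists_diagonalize_pointer
  set g : R3 → ℝ × ℝ := fun x => (x 1 / lam, 2 * Real.pi * x 2 / mu) with hg
  have hgm : Measurable g := by fun_prop
  set A : ι → L2 ℝ →L[ℂ] L2 R3 := fun i =>
    (F.toContinuousLinearEquiv : L2 R3 →L[ℂ] L2 R3) ∘L coupling lam mu κ ∘L tensorR (S (b i))
    with hA
  have hA_apply : ∀ i ψ, A i ψ = F (coupling lam mu κ (tensor ψ (S (b i)))) := fun i ψ => rfl
  have hAnorm : ∀ i, ‖A i‖ ≤ ‖S (b i)‖ := by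
    intro i
    refine ContinuousLinearMap.opNorm_le_bound _ (norm_nonneg _) fun ψ => ?_
    rw [hA_apply, F.norm_map, norm_coupling, norm_tensor, mul_comm]
  have hAsum : Summable fun i => ‖A i‖ ^ 2 :=
    hb.summable.of_nonneg_of_le (fun _ => by positivity)
      fun i => pow_le_pow_left₀ (norm_nonneg _) (hAnorm i) 2
  have hAone : ∀ φ ψ, HasSum (fun i => inner ℂ (A i φ) (A i ψ)) (inner ℂ φ ψ) := by
    intro φ ψ
    -- Unitarity leaves the factor `‖S bᵢ‖²`, and these factors sum to `tr σ = 1`.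
    have h1 : ∀ i, inner ℂ (A i φ) (A i ψ) = inner ℂ φ ψ * ((‖S (b i)‖ ^ 2 : ℝ) : ℂ) := by
      intro i
      rw [hA_apply, hA_apply, F.inner_map_map, inner_coupling, inner_tensor,
        inner_self_eq_norm_sq_to_K]
      norm_cast
    simp only [h1]
    have h2 := (Complex.hasSum_ofReal.2 hb).mul_left (inner ℂ φ ψ)
    simpa using h2
  refine ⟨(indicatorPOVM g hgm).compress (norm_indicatorPOVM_le g hgm) A hAsum hAone, ?_⟩
  intro X Y hX hY ψ _
  have h := hasTrace_coupling (lam := lam) (mu := mu) (κ := κ) b hadj hS hb ψ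
    (pointer ((fun x => lam * x) '' X) ((fun y => mu * y) '' Y))
  have hval := POVM.hasSum_inner_compress (indicatorPOVM g hgm) (norm_indicatorPOVM_le g hgm) A
    hAsum hAone (X ×ˢ Y) ψ ψ
  rw [← hval.tsum_eq]
  convert h using 3 with i
  have hX' : MeasurableSet ((fun x => lam * x) '' X) := by
    rw [image_mul_left_eq_preimage hlam]
    exact (measurable_id.div_const lam) hX
  have hY' : MeasurableSet ((fun y => mu * y) '' Y) := by
    rw [image_mul_left_eq_preimage hmu]
    exact (measurable_id.div_const mu) hY
  have hset : g ⁻¹' (X ×ˢ Y) = {x : R3 | x 1 ∈ (fun x => lam * x) '' X ∧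
      2 * Real.pi * x 2 ∈ (fun y => mu * y) '' Y} := by
    rw [image_mul_left_eq_preimage hlam, image_mul_left_eq_preimage hmu]
    rfl
  rw [indicatorPOVM_effect g hgm (hX.prod hY), hset, hA_apply, ← hF _ _ hX' hY', F.inner_map_map]

end Effective

/-- Operators are determined by their expectation values in unit vectors. -/
theorem ext_inner_unit {H : Type} [NormedAddCommGroup H] [InnerProductSpace ℂ H]
    {A B : H →L[ℂ] H} (h : ∀ ψ : H, ‖ψ‖ = 1 → inner ℂ ψ (A ψ) = inner ℂ ψ (B ψ)) : A = B := by
  have h' : ∀ ψ, inner ℂ ψ (A ψ) = inner ℂ ψ (B ψ) := by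
    intro ψ
    by_cases hψ : ψ = 0
    · simp [hψ]
    · have hn : (‖ψ‖ : ℂ) ≠ 0 := by exact_mod_cast norm_ne_zero_iff.2 hψ
      have h1 := h ((‖ψ‖ : ℂ)⁻¹ • ψ) (by
        rw [norm_smul, norm_inv, Complex.norm_real, norm_norm,
          inv_mul_cancel₀ (norm_ne_zero_iff.2 hψ)])
      simp only [map_smul, inner_smul_left, inner_smul_right] at h1
      have hn' : (starRingEnd ℂ) (‖ψ‖ : ℂ)⁻¹ ≠ 0 := by simpa using hψ
      exact mul_left_cancel₀ hn' (mul_left_cancel₀ (inv_ne_zero hn) h1)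
  -- Complex polarization: the quadratic form determines the operator.
  refine ContinuousLinearMap.coe_injective ((ext_inner_map _ _).1 fun ψ => ?_)
  change inner ℂ (A ψ) ψ = inner ℂ (B ψ) ψ
  rw [← inner_conj_symm, h', inner_conj_symm]

/-- Traces are unique, so the two observables agree on rectangles. Their complex measures for each
pair of vectors then agree on a generating π-system and on the whole space. -/
theorem IsEffectiveObservable.unique {lam mu κ : ℝ} {σ : L2 R2 →L[ℂ] L2 R2}
    {G G' : POVM (ℝ × ℝ) (L2 ℝ)} (hG : IsEffectiveObservable lam mu κ σ G)
    (hG' : IsEffectiveObservable lam mu κ σ G') : G = G' := by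
  have hrect : ∀ X Y, MeasurableSet X → MeasurableSet Y →
      G.effect (X ×ˢ Y) = G'.effect (X ×ˢ Y) := fun X Y hX hY =>
    ext_inner_unit fun ψ hψ => (hG X Y hX hY ψ hψ).unique (hG' X Y hX hY ψ hψ)
  refine POVM.ext_effect fun Z _ => ?_
  ext1 ψ
  refine ext_inner_left ℂ fun φ => ?_
  have h : G.toVectorMeasure φ ψ = G'.toVectorMeasure φ ψ := by
    refine VectorMeasure.ext_of_generateFrom _ ?_ generateFrom_prod.symm isPiSystem_prod ?_
    · rintro _ ⟨X, hX, Y, hY, rfl⟩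
      simp only [POVM.toVectorMeasure_apply, hrect X Y hX hY]
    · simp only [POVM.toVectorMeasure_apply, POVM.effect_univ]
  exact congrArg (fun v : VectorMeasure (ℝ × ℝ) ℂ => v Z) h

/-! ### Covariance -/

theorem adjoint_weyl_apply (q p : ℝ) (ψ : L2 ℝ) :
    ContinuousLinearMap.adjoint (weyl q p) ψ = ((weylFlow q p).at_ (-1)).op ψ := by
  refine ext_inner_left ℂ fun v => ?_
  have h : weyl q p (((weylFlow q p).at_ (-1)).op ψ) = ψ := by
    rw [weyl_apply, ← PhaseFlow.op_add, add_neg_cancel, PhaseFlow.op_zero]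
  rw [ContinuousLinearMap.adjoint_inner_right]
  conv_lhs => rw [← h]
  rw [weyl_apply, weyl_apply, LinearIsometry.inner_map_map]

/-- The image of a phase space translation of the system under the coupling. -/
def pointerShift (lam mu q p : ℝ) : PhaseMap R3 :=
  -- The translation vector is the one that the coupling map at time one sends to `q • dir 0`. The
  -- modulation is that of `W_{qp}*`, evaluated at the first coordinate `x 0 + mu * x 2` of the
  -- image point.
  displacement (-(p * q / 2)) (q • dir 0 + (lam * q) • dir 1)
    ((-(p / (2 * Real.pi))) • (dir 0 + mu • dir 2))

/-- Both sides are weighted compositions, so it suffices to compare maps and phases. The coupling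
map is linear, which turns a translation before it into a translation after it. -/
theorem coupling_tensor_adjoint_weyl (lam mu κ q p : ℝ) (ψ : L2 ℝ) (φ : L2 R2) :
    coupling lam mu κ (tensor (ContinuousLinearMap.adjoint (weyl q p) ψ) φ) =
      (pointerShift lam mu q p).op (coupling lam mu κ (tensor ψ φ)) := by
  rw [adjoint_weyl_apply, coupling_apply, coupling_apply]
  set c := (couplingFlow lam mu κ).at_ 1 with hc
  set w := (weylFlow q p).at_ (-1) with hw
  set d := pointerShift lam mu q p with hd
  have hcq := c.measurePreserving.quasiMeasurePreserving
  have hdq := d.measurePreserving.quasiMeasurePreserving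
  ext1
  filter_upwards [c.coeFn_op (tensor (w.op ψ) φ), hcq.ae (coeFn_tensor (w.op ψ) φ),
    hcq.ae (ae_split_fst (w.coeFn_op ψ)), d.coeFn_op (c.op (tensor ψ φ)),
    hdq.ae (c.coeFn_op (tensor ψ φ)), hdq.ae (hcq.ae (coeFn_tensor ψ φ))]
    with x h1 h2 h3 h4 h5 h6
  rw [h1, h2, h3, h4, h5, h6]
  have e0 : (c.map x) 0 = x 0 + mu * x 2 := by
    simp [hc, couplingFlow, couplingMap_apply]
  have em : split (c.map (d.map x)) = (w.map (split (c.map x)).1, (split (c.map x)).2) := by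
    refine Prod.ext ?_ ?_
    · simp [hc, hd, hw, split, couplingFlow, couplingMap_apply, pointerShift, displacement,
        weylFlow, dir]
      ring
    · ext i
      fin_cases i
      · simp [hc, hd, split, couplingFlow, couplingMap_apply, pointerShift, displacement, dir]
        ring
      · simp [hc, hd, split, couplingFlow, couplingMap_apply, pointerShift, displacement, dir]
  have ep : w.phase (split (c.map x)).1 = d.phase x := by
    have hs : (split (c.map x)).1 = x 0 + mu * x 2 := e0
    rw [hs]
    simp only [hw, hd, weylFlow, pointerShift, displacement]
    rw [mul_comm]
    congr 3
    simp only [inner_smul_left, inner_add_left, dir, EuclideanSpace.inner_single_left]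
    simp
    field_simp
    ring
  rw [em, ep]
  simp only [hc, couplingFlow, one_mul, mul_assoc]

/-- Only the component `lam * q` of the translation along `dir 1` meets `Q₁`, and only the frequency
along `dir 2`, equal to `-p * mu` after multiplication by `2π`, meets `P₂`. Division by `lam` and
`mu` leaves the shifts `q` and `p`. -/
theorem pointer_pointerShift {lam mu : ℝ} (hlam : lam ≠ 0) (hmu : mu ≠ 0) (q p : ℝ)
    {X Y : Set ℝ} (hX : MeasurableSet X) (hY : MeasurableSet Y) (f : L2 R3) :
    pointer ((fun x => lam * x) '' X) ((fun y => mu * y) '' Y) ((pointerShift lam mu q p).op f) =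
      (pointerShift lam mu q p).op (pointer ((fun x => lam * x) '' ((fun x => x - q) ⁻¹' X))
        ((fun y => mu * y) '' ((fun y => y - p) ⁻¹' Y)) f) := by
  change positionPVM _ _ (momentumPVM _ _ _) = (pointerShift lam mu q p).op
    (positionPVM _ _ (momentumPVM _ _ f))
  simp only [image_mul_left_eq_preimage hlam, image_mul_left_eq_preimage hmu]
  have h1 : inner ℝ (dir 1) (q • dir 0 + (lam * q) • dir 1) = lam * q := by
    simp [dir, EuclideanSpace.inner_single_left]
  have h2 : inner ℝ (dir 2) ((-(p / (2 * Real.pi))) • (dir 0 + mu • dir 2)) =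
      -(p / (2 * Real.pi)) * mu := by
    simp [dir, EuclideanSpace.inner_single_left]
  have hX' : MeasurableSet ((fun x => x / lam) ⁻¹' ((fun x => x - q) ⁻¹' X)) :=
    (measurable_id.div_const lam) ((measurable_id.sub_const q) hX)
  have hY' : MeasurableSet ((fun y => y / mu) ⁻¹' ((fun y => y - p) ⁻¹' Y)) :=
    (measurable_id.div_const mu) ((measurable_id.sub_const p) hY)
  rw [pointerShift, momentumPVM_displacement _ _ _ _ hY', positionPVM_displacement _ _ _ _ hX']
  · intro x
    rw [h1]
    simp only [Set.mem_preimage]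
    rw [show (x + lam * q) / lam - q = x / lam by field_simp; ring]
  · intro y
    rw [h2]
    simp only [Set.mem_preimage]
    rw [show (y - 2 * Real.pi * (-(p / (2 * Real.pi)) * mu)) / mu - p = y / mu by
      field_simp
      ring]

theorem IsEffectiveObservable.isCovariant {lam mu κ : ℝ} (hlam : lam ≠ 0) (hmu : mu ≠ 0)
    {σ : L2 R2 →L[ℂ] L2 R2} (hσ : IsDensityOperator σ) {G : POVM (ℝ × ℝ) (L2 ℝ)}
    (hG : IsEffectiveObservable lam mu κ σ G) : IsCovariant G := by
  obtain ⟨S, hadj, hS, hS1⟩ := hσ.exists_sqrt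
  obtain ⟨_, b, -⟩ := exists_hilbertBasis ℂ (L2 R2)
  intro q p
  set W := weyl q p with hW
  have hrect : ∀ X Y, MeasurableSet X → MeasurableSet Y →
      W ∘L G.effect (X ×ˢ Y) ∘L ContinuousLinearMap.adjoint W =
        G.effect (((fun x => x - q) ⁻¹' X) ×ˢ ((fun y => y - p) ⁻¹' Y)) := by
    intro X Y hX hY
    have hXq : MeasurableSet ((fun x => x - q) ⁻¹' X) := measurable_id.sub_const q hX
    have hYp : MeasurableSet ((fun y => y - p) ⁻¹' Y) := measurable_id.sub_const p hY
    refine ext_inner_unit fun ψ hψ => ?_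
    have hψ' : ‖ContinuousLinearMap.adjoint W ψ‖ = 1 := by
      rw [hW, adjoint_weyl_apply, LinearIsometry.norm_map, hψ]
    rw [ContinuousLinearMap.comp_apply, ContinuousLinearMap.comp_apply,
      ← ContinuousLinearMap.adjoint_inner_left,
      hG.inner_effect b hadj hS (hS1 _ b) hX hY hψ',
      hG.inner_effect b hadj hS (hS1 _ b) hXq hYp hψ]
    -- Each probe vector `S bᵢ` contributes separately: the displacement moves past the pointer and
    -- then cancels in the inner product.
    refine tsum_congr fun i => ?_
    rw [hW, coupling_tensor_adjoint_weyl, pointer_pointerShift hlam hmu q p hX hY,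
      LinearIsometry.inner_map_map]
  have hshift : Measurable fun z : ℝ × ℝ => z - (q, p) := measurable_id.sub_const _
  have himage : ∀ Z : Set (ℝ × ℝ), (fun z => z + (q, p)) '' Z = (fun z => z - (q, p)) ⁻¹' Z := by
    intro Z
    simp [sub_eq_add_neg]
  intro Z hZ
  ext1 ψ
  refine ext_inner_left ℂ fun φ => ?_
  -- Covariance on rectangles says that the measure for the transformed vectors and the translated
  -- measure agree on a π-system. This extends it to all Borel `Z`.
  have h : G.toVectorMeasure (ContinuousLinearMap.adjoint W φ) (ContinuousLinearMap.adjoint W ψ) =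
      (G.toVectorMeasure φ ψ).map (fun z => z - (q, p)) := by
    have hr : ∀ X Y, MeasurableSet X → MeasurableSet Y →
        G.toVectorMeasure (ContinuousLinearMap.adjoint W φ) (ContinuousLinearMap.adjoint W ψ)
          (X ×ˢ Y) = (G.toVectorMeasure φ ψ).map (fun z => z - (q, p)) (X ×ˢ Y) := by
      intro X Y hX hY
      rw [VectorMeasure.map_apply _ hshift (hX.prod hY), POVM.toVectorMeasure_apply,
        POVM.toVectorMeasure_apply, ContinuousLinearMap.adjoint_inner_left]
      exact congrArg (fun A : L2 ℝ →L[ℂ] L2 ℝ => inner ℂ φ (A ψ)) (hrect X Y hX hY)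
    refine VectorMeasure.ext_of_generateFrom _ ?_ generateFrom_prod.symm isPiSystem_prod ?_
    · rintro _ ⟨X, hX, Y, hY, rfl⟩
      exact hr X Y hX hY
    · rw [← Set.univ_prod_univ]
      exact hr _ _ MeasurableSet.univ MeasurableSet.univ
  have h' := congrArg (fun v : VectorMeasure (ℝ × ℝ) ℂ => v Z) h
  simp only [VectorMeasure.map_apply _ hshift hZ, POVM.toVectorMeasure_apply,
    ContinuousLinearMap.adjoint_inner_left] at h'
  rw [himage]
  exact h'

end ArthursKelly

end

/-! ### The main theorem -/

theorem theorem1 (lam mu κ : ℝ) (hlam : 0 < lam) (hmu : 0 < mu)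
    (σ : ArthursKelly.L2 ArthursKelly.R2 →L[ℂ] ArthursKelly.L2 ArthursKelly.R2)
    (hσ : ArthursKelly.IsDensityOperator σ) :
    (∃! G, ArthursKelly.IsEffectiveObservable lam mu κ σ G) ∧
      ∀ G, ArthursKelly.IsEffectiveObservable lam mu κ σ G → ArthursKelly.IsCovariant G := by
  obtain ⟨S, hadj, hS, hS1⟩ := hσ.exists_sqrt
  obtain ⟨_, b, -⟩ := exists_hilbertBasis ℂ (ArthursKelly.L2 ArthursKelly.R2)
  obtain ⟨G, hG⟩ := ArthursKelly.exists_isEffectiveObservable (κ := κ) b hlam.ne' hmu.ne' hadj hS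
    (hS1 _ b)
  exact ⟨⟨G, hG, fun G' hG' => hG'.unique hG⟩, fun G hG => hG.isCovariant hlam.ne' hmu.ne' hσ⟩
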